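/- **Notation.** Let $d\ge 1$ and $s\ge 1$ be integers and $\beta>-d-s$. Let $(a)_n=a(a+1)\cdots(a+n-1)$. Let $\mathcal H_m^{d,0}$ be the space of real homogeneous harmonic polynomials of degree $m$ in $d$ variables ($\mathcal H^{d,0}_m=\{0\}$ if $m<0$), $d\sigma$ the surface measure and $\omega_d$ the area of $\mathbb S^{d-1}$, and $\{Y_\ell^m: 1\le \ell\le\dim\mathcal H_m^{d,0}\}$ a basis of $\mathcal H_m^{d,0}$ that is orthonormal for $\frac1{\omega_d}\int_{\mathbb S^{d-1}}fg\,d\sigma$. Let $$P_n^{(a,b)}(u)=\frac1{n!}\sum_{k=0}^n\binom nk (n+a+b+1)_k\,(a+k+1)_{n-k}\Big(\frac{u-1}2\Big)^k$$ be the Jacobi polynomial, $A_n^{(a,b)}=\dfrac{2^n}{(n+a+b+1)_n}$, and for $a>-1-s$ $$J_n^{(a,-s)}(u)=\begin{cases}\dfrac{(u+1)^n}{n!}, & 0\le n\le s-1,\\[2mm] \displaystyle\int_{-1}^u\frac{(u-v)^{s-1}}{(s-1)!}\,A_{n-s}^{(a+s,0)}P_{n-s}^{(a+s,0)}(v)\,dv,&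 n\ge s.\end{cases}$$ For $0\le m\le n$ put $$\mathsf S^{n,(\beta,-s)}_{m,\ell}(x,t)=J^{(2m+\beta+d-1,-s)}_{n-m}(1-2t)\,Y^m_\ell(x),\qquad \mathsf S^{n,(\beta,\gamma)}_{m,\ell}(x,t)=P^{(2m+\beta+d-1,\gamma)}_{n-m}(1-2t)\,Y^m_\ell(x)\quad(\gamma>-1).$$ On the conic surface $\mathbb V_0^{d+1}=\{(x,t)\in\mathbb R^d\times\mathbb R:\|x\|=t,\ 0\le t\le1\}$ let $\int f\,d\mathsf m=\int_0^1t^{d-1}\int_{\mathbb S^{d-1}}f(t\xi,t)\,d\sigma(\xi)\,dt$. For $\beta>-d$ and $\gamma>-1$, $\mathcal V_n^d(\mathsf w_{\beta,\gamma})$ is the space of polynomials of degree at most $n$ restricted to $\mathbb V_0^{d+1}$ that are orthogonal to all polynomials of degree less than $n$ with respect to $\langle f,g\rangle_{\beta,\gamma}=b_{\beta,\gamma}\int fg\,t^\beta(1-t)^\gamma\,d\mathsf m$, where $b_{\beta,\gamma}$ normalizes $\langle1,1\rangle_{\beta,\gamma}=1$; it is $\{0\}$ for $n<0$. For fixed positive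 $\lambda_0,\dots,\lambda_{s-1}$ and $\beta>-d-s$, $\mathcal V_n^d(\mathsf w_{\beta,-s})$ is the space of polynomials of degree at most $n$ on $\mathbb V_0^{d+1}$ that are orthogonal to all polynomials on $\mathbb V_0^{d+1}$ of degree less than $n$ with respect to $$\langle f,g\rangle_{\beta,-s}=\frac1{\omega_d}\int \partial_t^sf\,\partial_t^sg\;t^{\beta+s}\,d\mathsf m+\sum_{k=0}^{s-1}\frac{\lambda_k}{\omega_d}\int_{\mathbb S^{d-1}}\partial_t^kf(\xi,1)\,\partial_t^kg(\xi,1)\,d\sigma(\xi).$$ Here a polynomial on $\mathbb V_0^{d+1}$ is represented by the unique polynomial in $(x,t)$ with that restriction that is harmonic in $x$, that is, by $\sum_i p_i(t)Y_i(x)$ with solid harmonics $Y_i$, its degree is the degree of this representative, and $\partial_t$ is the derivative in $t$ with $x$ fixed. **Statement.** (i) Let $\beta>-d-s$. For $0\le m\le n$, $1\le\ell\le\dim\mathcal H_m^{d,0}$ and all $(x,t)\in\mathbb R^d\times\mathbb R$, $$\mathsf S_{m,\ell}^{n,(\beta,-s)}(x,t)=\begin{cases} b_{m,n}^s\,(1-t)^s\,\mathsf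 S_{m,\ell}^{n-s,(\beta,s)}(x,t), & n-m\ge s,\\[1mm] \dfrac{2^{n-m}}{(n-m)!}\,(1-t)^{n-m}\,Y_\ell^m(x), & 0\le n-m\le s-1,\end{cases}\qquad b_{m,n}^s=\frac{(-1)^s2^sA_{n-s-m}^{(2m+\beta+d-1,s)}}{(-(n-m))_s}.$$ (ii) If moreover $\beta>-d$ (so that $\mathcal V^d_{n-s}(\mathsf w_{\beta,s})$ is defined), then for every $n\ge0$, as spaces of functions on $\mathbb V_0^{d+1}$, $$\mathcal V_n^d(\mathsf w_{\beta,-s})=\bigoplus_{j=0}^{s-1}(1-t)^j\,\mathcal H_{n-j}^{d,0}\;\oplus\;(1-t)^s\,\mathcal V_{n-s}^d(\mathsf w_{\beta,s}).$$ -/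

import Mathlib

open MeasureTheory

noncomputable section

namespace ConeSobolev

/-! ### One-variable polynomials -/

/-- The Pochhammer symbol `(a)_n = a (a + 1) ⋯ (a + n - 1)`. -/
def poch (a : ℝ) (n : ℕ) : ℝ := (ascPochhammer ℝ n).eval a

/-- The Jacobi polynomial
`P_n^{(α,β)}(x) = (α+1)_n / n! * ₂F₁(-n, n+α+β+1; α+1; (1-x)/2)`.
The hypergeometric sum is written with the quotient `(α+1)_n / (α+1)_k = (α+k+1)_{n-k}` cancelled
and with `(-n)_k / k! = (-1)^k * n.choose k`, so that it is a polynomial in `α`, `β`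
and is meaningful for all real parameters. -/
def jacobiP (α β : ℝ) (n : ℕ) (x : ℝ) : ℝ :=
  (1 / (n.factorial : ℝ)) * ∑ k ∈ Finset.range (n + 1),
    (n.choose k : ℝ) * poch (n + α + β + 1) k * poch (α + k + 1) (n - k) * ((x - 1) / 2) ^ k

/-- `A_n^{(α,β)} = 2^n / (n+α+β+1)_n`. -/
def jacobiA (α β : ℝ) (n : ℕ) : ℝ := 2 ^ n / poch (n + α + β + 1) n

/-- The renormalized Jacobi polynomial `A_n^{(α,β)} P_n^{(α,β)}`. -/
def jacobiHat (α β : ℝ) (n : ℕ) (x : ℝ) : ℝ := jacobiA α β n * jacobiP α β n x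

/-- The extension `J_n^{(α-s,β-s)}` of the Jacobi polynomials (for `α, β > -1` and `s ≥ 1`):
`(t+1)^n / n!` for `n < s`, and the `s`-fold antiderivative
`∫_{-1}^t (t-u)^{s-1}/(s-1)! * A_{n-s} P_{n-s}^{(α,β)}(u) du` for `n ≥ s`. -/
def jacobiJ (α β : ℝ) (s n : ℕ) (t : ℝ) : ℝ :=
  if n < s then (t + 1) ^ n / (n.factorial : ℝ)
  else ∫ u in (-1 : ℝ)..t, (t - u) ^ (s - 1) / ((s - 1).factorial : ℝ) * jacobiHat α β (n - s) u

/-! ### Polynomials in `(x,t)`, solid harmonics, and the cone -/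

/-- The Laplace operator on polynomials in `d` variables. -/
def laplacian (d : ℕ) :
    MvPolynomial (Fin d) ℝ →ₗ[ℝ] MvPolynomial (Fin d) ℝ :=
  ∑ i : Fin d, (MvPolynomial.pderiv i).toLinearMap ∘ₗ (MvPolynomial.pderiv i).toLinearMap

/-- The space `H_m^{d,0}` of homogeneous solid harmonics of degree `m` in `d` variables. -/
def solidHarmonics (d m : ℕ) : Submodule ℝ (MvPolynomial (Fin d) ℝ) :=
  MvPolynomial.homogeneousSubmodule (Fin d) ℝ m ⊓ LinearMap.ker (laplacian d)

/-- The polynomial ring `ℝ[x,t]`: the variable `some i` is `x_i`, the variable `none` is `t`. -/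
abbrev Poly (d : ℕ) := MvPolynomial (Option (Fin d)) ℝ

/-- The partial derivative `∂_t` with respect to the last variable (`x` is kept fixed). -/
def dt (d : ℕ) : Poly d →ₗ[ℝ] Poly d := (MvPolynomial.pderiv none).toLinearMap

/-- The Laplace operator in the `x` variables on `ℝ[x,t]`. -/
def laplacianX (d : ℕ) : Poly d →ₗ[ℝ] Poly d :=
  ∑ i : Fin d, (MvPolynomial.pderiv (some i)).toLinearMap ∘ₗ
    (MvPolynomial.pderiv (some i)).toLinearMap

/-- The value of a polynomial in `d` variables at a point of Euclidean space. -/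
def evalX {d : ℕ} (p : MvPolynomial (Fin d) ℝ) (x : EuclideanSpace ℝ (Fin d)) : ℝ :=
  MvPolynomial.eval (fun i => x i) p

/-- The value `P(x,t)`. -/
def evalXT {d : ℕ} (P : Poly d) (x : EuclideanSpace ℝ (Fin d)) (t : ℝ) : ℝ :=
  MvPolynomial.eval (fun o : Option (Fin d) => o.elim t (fun i => x i)) P

/-- The conic surface `{(x,t) : ‖x‖ = t, 0 ≤ t ≤ 1}`. -/
def cone (d : ℕ) : Set (EuclideanSpace ℝ (Fin d) × ℝ) :=
  {p | ‖p.1‖ = p.2 ∧ 0 ≤ p.2 ∧ p.2 ≤ 1}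

/-- Restriction of a polynomial in `(x,t)` to the conic surface. -/
def restrict (d : ℕ) : Poly d →ₗ[ℝ] (cone d → ℝ) where
  toFun P := fun p => evalXT P p.1.1 p.1.2
  map_add' P Q := by ext p; simp [evalXT]
  map_smul' c P := by ext p; simp [evalXT]

/-- The surface measure `dσ` of the unit sphere. -/
def sphereMeasure (d : ℕ) :
    Measure (Metric.sphere (0 : EuclideanSpace ℝ (Fin d)) 1) :=
  (volume : Measure (EuclideanSpace ℝ (Fin d))).toSphere

/-- The surface area `ω_d = 2 π^{d/2} / Γ(d/2)` of the unit sphere. -/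
def omega (d : ℕ) : ℝ := 2 * Real.pi ^ ((d : ℝ) / 2) / Real.Gamma ((d : ℝ) / 2)

/-- The integral over the unit sphere. -/
def sphereIntegral (d : ℕ) (f : EuclideanSpace ℝ (Fin d) → ℝ) : ℝ :=
  ∫ ξ, f ξ ∂(sphereMeasure d)

/-- The integral over the conic surface,
`∫ f dm = ∫_0^1 t^{d-1} ∫_{S^{d-1}} f(tξ,t) dσ(ξ) dt`. -/
def coneIntegral (d : ℕ) (f : EuclideanSpace ℝ (Fin d) → ℝ → ℝ) : ℝ :=
  ∫ t in (0 : ℝ)..1, t ^ (d - 1) * sphereIntegral d (fun ξ => f (t • ξ) t)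

/-- The Jacobi weight `w_{β,γ}(t) = t^β (1-t)^γ`. -/
def weight (β γ t : ℝ) : ℝ := t ^ β * (1 - t) ^ γ

/-- The normalization constant
`b_{β,γ} = ω_d⁻¹ Γ(β+γ+d+1) / (Γ(β+d) Γ(γ+1))`, for which `⟨1,1⟩_{β,γ} = 1`. -/
def normConst (d : ℕ) (β γ : ℝ) : ℝ :=
  1 / omega d * (Real.Gamma (β + γ + d + 1) / (Real.Gamma (β + d) * Real.Gamma (γ + 1)))

/-- The inner product `⟨P,Q⟩_{β,γ} = b_{β,γ} ∫ P Q w_{β,γ} dm` over the conic surface. -/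
def coneInner (d : ℕ) (β γ : ℝ) (P Q : Poly d) : ℝ :=
  normConst d β γ * coneIntegral d (fun x t => evalXT P x t * evalXT Q x t * weight β γ t)

/-- The Sobolev inner product `⟨P,Q⟩_{β,-s}`:
`ω_d⁻¹ ∫ ∂_t^s P ∂_t^s Q t^{β+s} dm + ∑_{k<s} λ_k ω_d⁻¹ ∫_{S^{d-1}} ∂_t^k P(ξ,1) ∂_t^k Q(ξ,1) dσ(ξ)`. -/
def sobolevInner (d : ℕ) (β : ℝ) (s : ℕ) (lam : ℕ → ℝ) (P Q : Poly d) : ℝ :=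
  1 / omega d * coneIntegral d (fun x t =>
      evalXT ((dt d)^[s] P) x t * evalXT ((dt d)^[s] Q) x t * t ^ (β + s))
    + ∑ k ∈ Finset.range s, lam k / omega d * sphereIntegral d (fun ξ =>
        evalXT ((dt d)^[k] P) ξ 1 * evalXT ((dt d)^[k] Q) ξ 1)

/-! ### Bilinearity of the two inner products on polynomials -/

lemma continuous_evalXT {d : ℕ} (P : Poly d) :
    Continuous (fun p : EuclideanSpace ℝ (Fin d) × ℝ => evalXT P p.1 p.2) := by
  unfold evalXT
  refine (MvPolynomial.continuous_eval P).comp ?_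
  refine continuous_pi fun o => ?_
  cases o with
  | none => simpa using continuous_snd
  | some i => simp only [Option.elim]; fun_prop

@[simp] lemma evalXT_add {d : ℕ} (P Q : Poly d) (x : EuclideanSpace ℝ (Fin d)) (t : ℝ) :
    evalXT (P + Q) x t = evalXT P x t + evalXT Q x t := by simp [evalXT]

@[simp] lemma evalXT_smul {d : ℕ} (c : ℝ) (P : Poly d) (x : EuclideanSpace ℝ (Fin d)) (t : ℝ) :
    evalXT (c • P) x t = c * evalXT P x t := by simp [evalXT]

instance (d : ℕ) : IsFiniteMeasure (sphereMeasure d) := by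
  unfold sphereMeasure; infer_instance

lemma sphereIntegral_add {d : ℕ} {f g : EuclideanSpace ℝ (Fin d) → ℝ}
    (hf : Continuous f) (hg : Continuous g) :
    sphereIntegral d (fun x => f x + g x) = sphereIntegral d f + sphereIntegral d g := by
  have key : ∀ h : EuclideanSpace ℝ (Fin d) → ℝ, Continuous h →
      Integrable (fun ξ : Metric.sphere (0 : EuclideanSpace ℝ (Fin d)) 1 => h ξ)
        (sphereMeasure d) := fun h hh => by
    have := (hh.comp continuous_subtype_val).continuousOn.integrableOn_compact
      (μ := sphereMeasure d) (isCompact_univ (X := Metric.sphere (0 : EuclideanSpace ℝ (Fin d)) 1))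
    exact integrableOn_univ.mp this
  exact integral_add (key f hf) (key g hg)

lemma sphereIntegral_const_mul {d : ℕ} (c : ℝ) (f : EuclideanSpace ℝ (Fin d) → ℝ) :
    sphereIntegral d (fun x => c * f x) = c * sphereIntegral d f :=
  integral_const_mul c _

lemma sphereIntegral_mul_const {d : ℕ} (c : ℝ) (f : EuclideanSpace ℝ (Fin d) → ℝ) :
    sphereIntegral d (fun x => f x * c) = sphereIntegral d f * c :=
  integral_mul_const c _

lemma coneIntegral_const_mul {d : ℕ} (c : ℝ) (f : EuclideanSpace ℝ (Fin d) → ℝ → ℝ) :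
    coneIntegral d (fun x t => c * f x t) = c * coneIntegral d f := by
  simp only [coneIntegral, sphereIntegral_const_mul, ← intervalIntegral.integral_const_mul]
  congr 1; ext t; ring

lemma coneIntegral_add {d : ℕ} {w : ℝ → ℝ}
    (hw : IntervalIntegrable (fun t => t ^ (d - 1) * w t) volume 0 1)
    {f g : EuclideanSpace ℝ (Fin d) → ℝ → ℝ}
    (hf : Continuous fun p : EuclideanSpace ℝ (Fin d) × ℝ => f p.1 p.2)
    (hg : Continuous fun p : EuclideanSpace ℝ (Fin d) × ℝ => g p.1 p.2) :
    coneIntegral d (fun x t => (f x t + g x t) * w t) =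
      coneIntegral d (fun x t => f x t * w t) + coneIntegral d (fun x t => g x t * w t) := by
  have key : ∀ h : EuclideanSpace ℝ (Fin d) → ℝ → ℝ,
      Continuous (fun p : EuclideanSpace ℝ (Fin d) × ℝ => h p.1 p.2) →
      IntervalIntegrable
        (fun t => t ^ (d - 1) * (sphereIntegral d (fun ξ => h (t • ξ) t) * w t)) volume 0 1 := by
    intro h hh
    have hc : Continuous (fun t : ℝ => sphereIntegral d (fun ξ => h (t • ξ) t)) := by
      unfold sphereIntegral
      have hu : Continuous (Function.uncurry (fun (t : ℝ)
          (ξ : Metric.sphere (0 : EuclideanSpace ℝ (Fin d)) 1) =>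
            h (t • (ξ : EuclideanSpace ℝ (Fin d))) t)) :=
        hh.comp (f := fun q : ℝ × Metric.sphere (0 : EuclideanSpace ℝ (Fin d)) 1 =>
          (q.1 • (q.2 : EuclideanSpace ℝ (Fin d)), q.1)) (by fun_prop)
      have := continuous_parametric_integral_of_continuous (μ := sphereMeasure d) hu
        (isCompact_univ (X := Metric.sphere (0 : EuclideanSpace ℝ (Fin d)) 1))
      simpa using this
    have := hw.mul_continuousOn hc.continuousOn
    refine this.congr ?_
    exact fun t _ => by ring
  simp only [coneIntegral, sphereIntegral_mul_const]
  rw [← intervalIntegral.integral_add (key f hf) (key g hg)]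
  congr 1; ext t
  rw [sphereIntegral_add (f := fun ξ => f (t • ξ) t) (g := fun ξ => g (t • ξ) t)
    (hf.comp (f := fun ξ : EuclideanSpace ℝ (Fin d) => (t • ξ, t)) (by fun_prop))
    (hg.comp (f := fun ξ : EuclideanSpace ℝ (Fin d) => (t • ξ, t)) (by fun_prop))]
  ring

lemma intervalIntegrable_rpow_mul {a c : ℝ} (ha : -1 < a) (hc : -1 < c) :
    IntervalIntegrable (fun t : ℝ => t ^ a * (1 - t) ^ c) volume 0 1 := by
  have h := (Complex.betaIntegral_convergent (u := ((a + 1 : ℝ) : ℂ)) (v := ((c + 1 : ℝ) : ℂ))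
    (by simpa using by linarith) (by simpa using by linarith)).norm
  refine h.congr_ae ?_
  rw [Set.uIoc_of_le zero_le_one]
  have h1 : ∀ᵐ t : ℝ, t ≠ 1 := by simp [ae_iff]
  filter_upwards [ae_restrict_mem measurableSet_Ioc, ae_restrict_of_ae h1] with t ht ht1
  have ht0 : 0 < t := ht.1
  have ht2 : 0 < 1 - t := by
    have := lt_of_le_of_ne ht.2 ht1
    linarith
  have e : (1 : ℂ) - (t : ℂ) = ((1 - t : ℝ) : ℂ) := by push_cast; ring
  rw [e, norm_mul, Complex.norm_cpow_eq_rpow_re_of_pos ht0,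
    Complex.norm_cpow_eq_rpow_re_of_pos ht2]
  simp

lemma intervalIntegrable_weight {d : ℕ} {β γ : ℝ} (hβ : -(d : ℝ) < β) (hγ : -1 < γ) :
    IntervalIntegrable (fun t => t ^ (d - 1) * weight β γ t) volume 0 1 := by
  rcases Nat.eq_zero_or_pos d with rfl | hd
  · have : -1 < β := by simp at hβ; linarith
    simpa [weight] using intervalIntegrable_rpow_mul this hγ
  · have hc : ((d - 1 : ℕ) : ℝ) = (d : ℝ) - 1 := by simp [Nat.cast_sub hd]
    refine (intervalIntegrable_rpow_mul (a := ((d - 1 : ℕ) : ℝ) + β) (by rw [hc]; linarith)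
      hγ).congr ?_
    rw [Set.uIoc_of_le zero_le_one]
    intro t ht
    simp only [weight]
    rw [Real.rpow_add ht.1, Real.rpow_natCast, mul_assoc]

lemma coneInner_add_left {d : ℕ} {β γ : ℝ} (hβ : -(d : ℝ) < β) (hγ : -1 < γ) (P P' Q : Poly d) :
    coneInner d β γ (P + P') Q = coneInner d β γ P Q + coneInner d β γ P' Q := by
  simp only [coneInner, evalXT_add, add_mul (evalXT P _ _)]
  rw [coneIntegral_add (intervalIntegrable_weight hβ hγ)
    ((continuous_evalXT P).mul (continuous_evalXT Q))
    ((continuous_evalXT P').mul (continuous_evalXT Q)), mul_add]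

lemma coneInner_smul_left {d : ℕ} {β γ : ℝ} (c : ℝ) (P Q : Poly d) :
    coneInner d β γ (c • P) Q = c * coneInner d β γ P Q := by
  simp only [coneInner, evalXT_smul, mul_assoc, coneIntegral_const_mul]
  ring

lemma dt_iterate_add {d : ℕ} (k : ℕ) (P Q : Poly d) :
    (dt d)^[k] (P + Q) = (dt d)^[k] P + (dt d)^[k] Q := iterate_map_add (dt d) k P Q

lemma dt_iterate_smul {d : ℕ} (k : ℕ) (c : ℝ) (P : Poly d) :
    (dt d)^[k] (c • P) = c • (dt d)^[k] P := by
  induction k generalizing P with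
  | zero => rfl
  | succ k ih => simp only [Function.iterate_succ_apply, map_smul, ih]

lemma sobolevInner_add_left {d : ℕ} {β : ℝ} {s : ℕ} (hβ : -(d : ℝ) - s < β) (lam : ℕ → ℝ)
    (P P' Q : Poly d) :
    sobolevInner d β s lam (P + P') Q =
      sobolevInner d β s lam P Q + sobolevInner d β s lam P' Q := by
  have hw : IntervalIntegrable (fun t : ℝ => t ^ (d - 1) * t ^ (β + s)) volume 0 1 := by
    have := intervalIntegrable_weight (d := d) (β := β + s) (γ := 0) (by linarith) (by norm_num)
    simpa [weight] using this
  have hc : ∀ R : Poly d, Continuous fun x : EuclideanSpace ℝ (Fin d) => evalXT R x 1 :=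
    fun R => (continuous_evalXT R).comp (f := fun x : EuclideanSpace ℝ (Fin d) => (x, (1 : ℝ)))
      (by fun_prop)
  simp only [sobolevInner, dt_iterate_add, evalXT_add, add_mul (evalXT _ _ _)]
  rw [coneIntegral_add hw
    ((continuous_evalXT ((dt d)^[s] P)).mul (continuous_evalXT ((dt d)^[s] Q)))
    ((continuous_evalXT ((dt d)^[s] P')).mul (continuous_evalXT ((dt d)^[s] Q)))]
  have hs : ∀ k, sphereIntegral d (fun ξ =>
      evalXT ((dt d)^[k] P) ξ 1 * evalXT ((dt d)^[k] Q) ξ 1 +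
        evalXT ((dt d)^[k] P') ξ 1 * evalXT ((dt d)^[k] Q) ξ 1) = _ :=
    fun k => sphereIntegral_add ((hc _).mul (hc _)) ((hc _).mul (hc _))
  simp only [hs, mul_add, Finset.sum_add_distrib]
  ring

lemma sobolevInner_smul_left {d : ℕ} {β : ℝ} {s : ℕ} (lam : ℕ → ℝ) (c : ℝ) (P Q : Poly d) :
    sobolevInner d β s lam (c • P) Q = c * sobolevInner d β s lam P Q := by
  simp only [sobolevInner, dt_iterate_smul, evalXT_smul, mul_assoc, coneIntegral_const_mul,
    sphereIntegral_const_mul, mul_add, Finset.mul_sum]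
  congr 1
  · ring
  · exact Finset.sum_congr rfl fun k _ => by ring

lemma coneInner_zero_left {d : ℕ} {β γ : ℝ} (Q : Poly d) : coneInner d β γ 0 Q = 0 := by
  simpa using coneInner_smul_left (β := β) (γ := γ) 0 0 Q

lemma sobolevInner_zero_left {d : ℕ} {β : ℝ} {s : ℕ} (lam : ℕ → ℝ) (Q : Poly d) :
    sobolevInner d β s lam 0 Q = 0 := by
  simpa using sobolevInner_smul_left (β := β) (s := s) lam 0 0 Q

/-! ### Spaces of orthogonal polynomials on the cone -/

/-- The space `V_n^d(w_{β,γ})` (`β > -d`, `γ > -1`) of orthogonal polynomials of degree `n` on the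
conic surface: restrictions to the cone of polynomials of degree at most `n` in `(x,t)` that are
orthogonal to all polynomials of degree less than `n` for `⟨·,·⟩_{β,γ}`. -/
def orthPoly (d : ℕ) (β γ : ℝ) (hβ : -(d : ℝ) < β) (hγ : -1 < γ) (n : ℕ) :
    Submodule ℝ (cone d → ℝ) where
  carrier := {f | ∃ P : Poly d, P.totalDegree ≤ n ∧ restrict d P = f ∧
    ∀ Q : Poly d, Q.totalDegree < n → coneInner d β γ P Q = 0}
  zero_mem' := ⟨0, by simp, by simp, fun Q _ => coneInner_zero_left Q⟩
  add_mem' := by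
    rintro _ _ ⟨P, hP, rfl, hPo⟩ ⟨P', hP', rfl, hPo'⟩
    refine ⟨P + P', (MvPolynomial.totalDegree_add P P').trans (max_le hP hP'), map_add _ _ _,
      fun Q hQ => ?_⟩
    rw [coneInner_add_left hβ hγ, hPo Q hQ, hPo' Q hQ, add_zero]
  smul_mem' := by
    rintro c _ ⟨P, hP, rfl, hPo⟩
    refine ⟨c • P, (MvPolynomial.totalDegree_smul_le c P).trans hP, map_smul _ _ _,
      fun Q hQ => ?_⟩
    rw [coneInner_smul_left, hPo Q hQ, mul_zero]

/-- The space `V_n^d(w_{β,-s})` (`β > -d-s`) of Sobolev orthogonal polynomials of degree `n` on the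
conic surface.

The derivative `∂_t` with `x` fixed is not well defined modulo `t^2 - ‖x‖^2`, so a polynomial on
the cone is represented by its unique representative `∑ p_i(t) Y_i(x)`, `Y_i` solid harmonics,
i.e. by the unique polynomial in `(x,t)` with the same restriction to the cone that is harmonic in
`x`; this representative also realizes the degree of the polynomial on the cone.
`V_n^d(w_{β,-s})` consists of the polynomials on the cone of degree at most `n` that are
orthogonal to all polynomials on the cone of degree less than `n` for `⟨·,·⟩_{β,-s}`. -/
def sobolevOrthPoly (d : ℕ) (β : ℝ) (s : ℕ) (hβ : -(d : ℝ) - s < β) (lam : ℕ → ℝ) (n : ℕ) :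
    Submodule ℝ (cone d → ℝ) where
  carrier := {f | ∃ P : Poly d, laplacianX d P = 0 ∧ P.totalDegree ≤ n ∧ restrict d P = f ∧
    ∀ Q : Poly d, laplacianX d Q = 0 → Q.totalDegree < n → sobolevInner d β s lam P Q = 0}
  zero_mem' := ⟨0, by simp, by simp, by simp, fun Q _ _ => sobolevInner_zero_left lam Q⟩
  add_mem' := by
    rintro _ _ ⟨P, hPh, hP, rfl, hPo⟩ ⟨P', hPh', hP', rfl, hPo'⟩
    refine ⟨P + P', by rw [map_add, hPh, hPh', add_zero],
      (MvPolynomial.totalDegree_add P P').trans (max_le hP hP'), map_add _ _ _,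
      fun Q hQh hQ => ?_⟩
    rw [sobolevInner_add_left hβ, hPo Q hQh hQ, hPo' Q hQh hQ, add_zero]
  smul_mem' := by
    rintro c _ ⟨P, hPh, hP, rfl, hPo⟩
    refine ⟨c • P, by rw [map_smul, hPh, smul_zero],
      (MvPolynomial.totalDegree_smul_le c P).trans hP, map_smul _ _ _, fun Q hQh hQ => ?_⟩
    rw [sobolevInner_smul_left, hPo Q hQh hQ, mul_zero]

/-- `V_k^d(w_{β,γ})` for an integer index `k`: it is `{0}` for `k < 0`. -/
def orthPolyInt (d : ℕ) (β γ : ℝ) (hβ : -(d : ℝ) < β) (hγ : -1 < γ) (k : ℤ) :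
    Submodule ℝ (cone d → ℝ) :=
  if 0 ≤ k then orthPoly d β γ hβ hγ k.toNat else ⊥

/-- `H_k^{d,0}` for an integer index `k`, as a space of functions `(x,t) ↦ Y(x)` on the cone:
it is `{0}` for `k < 0`. -/
def harmonicsOnCone (d : ℕ) (k : ℤ) : Submodule ℝ (cone d → ℝ) :=
  if 0 ≤ k then
    (solidHarmonics d k.toNat).map
      (restrict d ∘ₗ (MvPolynomial.rename (R := ℝ) (some : Fin d → Option (Fin d))).toLinearMap)
  else ⊥

/-- The space `(1-t)^j W` for a space `W` of functions on the cone. -/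
def oneSubTPowMul (d j : ℕ) (W : Submodule ℝ (cone d → ℝ)) : Submodule ℝ (cone d → ℝ) :=
  W.map (LinearMap.mulLeft ℝ (fun p : cone d => (1 - p.1.2) ^ j))

/-! ### The two families of polynomials -/

/-- The Jacobi polynomials on the cone,
`S_m^{n,(β,γ)}(x,t) = P_{n-m}^{(2m+β+d-1,γ)}(1-2t) Y(x)` with `Y` a solid harmonic of degree `m`
and `m ≤ n`. -/
def coneS (d : ℕ) (β γ : ℝ) (n m : ℕ) (Y : MvPolynomial (Fin d) ℝ)
    (x : EuclideanSpace ℝ (Fin d)) (t : ℝ) : ℝ :=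
  jacobiP (2 * m + β + d - 1) γ (n - m) (1 - 2 * t) * evalX Y x

/-- The Sobolev polynomials on the cone,
`S_m^{n,(β,-s)}(x,t) = J_{n-m}^{(2m+β+d-1,-s)}(1-2t) Y(x)` with `Y` a solid harmonic of degree `m`
and `m ≤ n`. -/
def sobolevS (d : ℕ) (β : ℝ) (s n m : ℕ) (Y : MvPolynomial (Fin d) ℝ)
    (x : EuclideanSpace ℝ (Fin d)) (t : ℝ) : ℝ :=
  jacobiJ (2 * m + β + d - 1 + s) 0 s (n - m) (1 - 2 * t) * evalX Y x

/-- The constant `b_{m,n}^s = (-1)^s 2^s A_{n-s-m}^{(2m+β+d-1,s)} / (-(n-m))_s`, for `m + s ≤ n`. -/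
def bConst (d : ℕ) (β : ℝ) (s n m : ℕ) : ℝ :=
  (-1) ^ s * 2 ^ s * jacobiA (2 * m + β + d - 1) s (n - s - m) / poch (-((n : ℝ) - m)) s

end ConeSobolev

end

open ConeSobolev

noncomputable section

namespace ConeSobolev

/-! ### Jacobi polynomials -/

/-! (i) is a statement in one variable. Since `((1+x)^β P_n^{(α,β)})' = (n+β) (1+x)^(β-1)
P_n^{(α+1,β-1)}`, each integration by parts in the `s`-fold antiderivative defining `J` removes one
power of the kernel, raises the second Jacobi parameter and lowers the first. After `s` steps only
`(1+x)^s P^{(a,s)}` and a quotient of factorials remain (`integral_sub_pow_mul_jacobiP`,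
`jacobiJ_eq`).

(ii) reduces to one variable through the expansion `∑ c_i(t) Y_i(x)`. On the cone `‖x‖² = t²`, so
Fischer's decomposition gives every polynomial such a representative without raising the degree.
Solid harmonics of different degrees are orthogonal on the sphere, so both inner products are
diagonal in `i`. On a harmonic of degree `m` the Sobolev product becomes, with `α = 2m+β+d-1`, the
form `∫ t^(α+s) p^(s) q^(s) + ∑ λ_k p^(k)(1) q^(k)(1)`, and `p` has degree at most `N = n-m`.

Testing this form with `(t-1)^k` shows that an orthogonal `p` is divisible by `(1-t)^min(s,N)`. If
`N < s`, then `p` is a multiple of `(1-t)^N`. If `N ≥ s`, the boundary sum vanishes and `s`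
integrations by parts turn the integral into `±∫ t^α p D(q^(s))`, where `D` multiplies `t^i` by
`(α+1+i)_s`. For `α > -1` the operator `D` is invertible, so `D(q^(s))` runs through all polynomials
of degree less than `N-s`. Hence `p/(1-t)^s` is orthogonal for the weight `t^α (1-t)^s`. The sum is
direct because its summands involve disjoint sets of harmonic degrees. -/

lemma poch_zero (a : ℝ) : poch a 0 = 1 := by simp [poch]

lemma poch_succ_right (a : ℝ) (n : ℕ) : poch a (n + 1) = poch a n * (a + n) :=
  ascPochhammer_succ_eval n a

lemma poch_succ_left (a : ℝ) (n : ℕ) : poch a (n + 1) = a * poch (a + 1) n := by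
  simp [poch, ascPochhammer_succ_left, Polynomial.eval_comp]

/-- The coefficients of `n! P_n^{(α,β)}` in powers of `(x - 1) / 2`. -/
def jacobiCoeff (α β : ℝ) (n k : ℕ) : ℝ :=
  (n.choose k : ℝ) * poch (n + α + β + 1) k * poch (α + k + 1) (n - k)

lemma jacobiP_eq_sum (α β : ℝ) (n : ℕ) (x : ℝ) :
    jacobiP α β n x =
      1 / (n.factorial : ℝ) * ∑ k ∈ Finset.range (n + 1), jacobiCoeff α β n k * ((x - 1) / 2) ^ k :=
  rfl

/-- The coefficient of `z^k`, `z = (x-1)/2`, in `deriv_jacobiP_relation`. The sum `α + β` is the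
same on both sides, so all reduces to `(k+1) C(n,k+1) = (n-k) C(n,k)`. -/
lemma jacobiCoeff_recurrence (α β : ℝ) {n k : ℕ} (hk : k ≤ n) :
    (k + β) * jacobiCoeff α β n k + (k + 1) * jacobiCoeff α β n (k + 1) =
      (n + β) * jacobiCoeff (α + 1) (β - 1) n k := by
  have hβ : (n : ℝ) + (α + 1) + (β - 1) + 1 = n + α + β + 1 := by ring
  obtain rfl | hlt := hk.eq_or_lt
  · simp [jacobiCoeff, poch_zero, hβ]
  obtain ⟨j, rfl⟩ : ∃ j, n = k + j + 1 := ⟨n - k - 1, by omega⟩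
  have hc : ((k + j + 1).choose (k + 1) : ℝ) * (k + 1) = (k + j + 1).choose k * (j + 1) := by
    have := Nat.choose_succ_right_eq (k + j + 1) k
    rw [show k + j + 1 - k = j + 1 by omega] at this
    exact_mod_cast this
  have e1 : k + j + 1 - k = j + 1 := by omega
  have e2 : k + j + 1 - (k + 1) = j := by omega
  have e3 : α + k + 1 + 1 = α + (k + 1 : ℕ) + 1 := by push_cast; ring
  have e4 : α + 1 + k + 1 = α + (k + 1 : ℕ) + 1 := by push_cast; ring
  simp only [jacobiCoeff, hβ, e1, e2, e4]
  rw [poch_succ_left (α + k + 1) j, e3, poch_succ_right _ j, poch_succ_right _ k]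
  push_cast at hc ⊢
  linear_combination (poch (k + j + 1 + α + β + 1) k * (k + j + 1 + α + β + 1 + k) *
    poch (α + (k + 1) + 1) j) * hc

lemma jacobiCoeff_of_lt (α β : ℝ) {n k : ℕ} (h : n < k) : jacobiCoeff α β n k = 0 := by
  simp [jacobiCoeff, Nat.choose_eq_zero_of_lt h]

lemma continuous_jacobiP (α β : ℝ) (n : ℕ) : Continuous (jacobiP α β n) := by
  unfold jacobiP
  fun_prop

lemma hasDerivAt_jacobiP (α β : ℝ) (n : ℕ) (x : ℝ) :
    HasDerivAt (jacobiP α β n) (1 / (n.factorial : ℝ) * ∑ k ∈ Finset.range (n + 1),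
      jacobiCoeff α β n k * (k * ((x - 1) / 2) ^ (k - 1) * (1 / 2))) x := by
  have hz : HasDerivAt (fun y : ℝ => (y - 1) / 2) (1 / 2) x :=
    ((hasDerivAt_id x).sub_const 1).div_const 2
  exact (HasDerivAt.fun_sum fun k _ => (hz.fun_pow k).const_mul _).const_mul _

/-- The derivative formula for `(1+x)^β P_n^{(α,β)}` with the common factor `(1+x)^(β-1)` removed.
In this form it is a polynomial identity for all real parameters. -/
lemma deriv_jacobiP_relation (α β : ℝ) (n : ℕ) (x : ℝ) :
    (1 + x) * deriv (jacobiP α β n) x + β * jacobiP α β n x =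
      (n + β) * jacobiP (α + 1) (β - 1) n x := by
  rw [(hasDerivAt_jacobiP α β n x).deriv]
  simp only [jacobiP_eq_sum]
  set z := (x - 1) / 2 with hz
  have hx : 1 + x = 2 * (z + 1) := by rw [hz]; ring
  -- After the index shift the upper limit can stay the same, because the coefficient of index `n +
  -- 1` is zero.
  have hshift : ∑ k ∈ Finset.range (n + 1), jacobiCoeff α β n k * (k * z ^ (k - 1)) =
      ∑ k ∈ Finset.range (n + 1), (k + 1) * jacobiCoeff α β n (k + 1) * z ^ k := by
    rw [Finset.sum_range_succ', Finset.sum_range_succ _ n, jacobiCoeff_of_lt α β n.lt_succ_self]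
    simp only [Nat.cast_zero, zero_mul, mul_zero, add_zero]
    refine Finset.sum_congr rfl fun k _ => ?_
    push_cast
    ring
  have hsame : ∑ k ∈ Finset.range (n + 1), jacobiCoeff α β n k * (k * z ^ (k - 1)) * z =
      ∑ k ∈ Finset.range (n + 1), k * jacobiCoeff α β n k * z ^ k := by
    refine Finset.sum_congr rfl fun k _ => ?_
    cases k with
    | zero => simp
    | succ k => simp only [Nat.add_sub_cancel]; ring
  have hrec : (n + β) * ∑ k ∈ Finset.range (n + 1), jacobiCoeff (α + 1) (β - 1) n k * z ^ k =
      ∑ k ∈ Finset.range (n + 1), k * jacobiCoeff α β n k * z ^ k +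
      β * ∑ k ∈ Finset.range (n + 1), jacobiCoeff α β n k * z ^ k +
      ∑ k ∈ Finset.range (n + 1), (k + 1) * jacobiCoeff α β n (k + 1) * z ^ k := by
    rw [Finset.mul_sum, Finset.mul_sum, ← Finset.sum_add_distrib, ← Finset.sum_add_distrib]
    refine Finset.sum_congr rfl fun k hk => ?_
    linear_combination (-z ^ k) * jacobiCoeff_recurrence α β
      (Nat.lt_succ_iff.mp (Finset.mem_range.mp hk))
  have hhalf : ∑ k ∈ Finset.range (n + 1), jacobiCoeff α β n k * (k * z ^ (k - 1) * (1 / 2)) =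
      1 / 2 * ∑ k ∈ Finset.range (n + 1), jacobiCoeff α β n k * (k * z ^ (k - 1)) := by
    rw [Finset.mul_sum]
    exact Finset.sum_congr rfl fun k _ => by ring
  rw [← Finset.sum_mul] at hsame
  rw [hhalf, hx]
  linear_combination (1 / (n.factorial : ℝ)) * (hsame + hshift - hrec)

/-! ### Iterated antiderivatives of Jacobi polynomials. -/

lemma hasDerivAt_one_add_pow_mul_jacobiP (α : ℝ) (j n : ℕ) (x : ℝ) :
    HasDerivAt (fun y => (1 + y) ^ (j + 1) * jacobiP α (j + 1 : ℕ) n y)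
      ((n + (j + 1 : ℕ)) * ((1 + x) ^ j * jacobiP (α + 1) j n x)) x := by
  have h1 : HasDerivAt (fun y : ℝ => (1 + y) ^ (j + 1)) ((j + 1 : ℕ) * (1 + x) ^ j * 1) x :=
    ((hasDerivAt_id x).const_add 1).fun_pow (j + 1)
  have h2 := (hasDerivAt_jacobiP α (j + 1 : ℕ) n x).differentiableAt.hasDerivAt
  refine (h1.fun_mul h2).congr_deriv ?_
  have h3 := deriv_jacobiP_relation α (j + 1 : ℕ) n x
  rw [show ((j + 1 : ℕ) : ℝ) - 1 = j by push_cast; ring] at h3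
  linear_combination (1 + x) ^ j * h3

lemma integral_one_add_pow_mul_jacobiP (α : ℝ) (j n : ℕ) (x : ℝ) :
    ∫ v in (-1 : ℝ)..x, (n + (j + 1 : ℕ)) * ((1 + v) ^ j * jacobiP (α + 1) j n v) =
      (1 + x) ^ (j + 1) * jacobiP α (j + 1 : ℕ) n x := by
  rw [intervalIntegral.integral_eq_sub_of_hasDerivAt
    (fun v _ => hasDerivAt_one_add_pow_mul_jacobiP α j n v)
    (Continuous.intervalIntegrable (by have := continuous_jacobiP (α + 1) j n; fun_prop) _ _)]
  simp

/-- Integration by parts lowers the kernel exponent by one and replaces `j` by `j + 1`, which is why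
`j` is generalized in the induction. The endpoint terms vanish through `(x-v)^(s+1)` at `x` and
`(1+v)^(j+1)` at `-1`. Each step divides by `n + j + 1`, and these divisors build the quotient of
factorials. -/
lemma integral_sub_pow_mul_jacobiP (α : ℝ) (s j n : ℕ) (x : ℝ) :
    ∫ v in (-1 : ℝ)..x, (x - v) ^ s / (s.factorial : ℝ) *
        ((1 + v) ^ j * jacobiP (α + (s + 1 : ℕ)) j n v) =
      ((n + j).factorial : ℝ) / ((n + j + s + 1).factorial : ℝ) *
        ((1 + x) ^ (j + s + 1) * jacobiP α (j + s + 1 : ℕ) n x) := by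
  induction s generalizing j with
  | zero =>
    have h := integral_one_add_pow_mul_jacobiP α j n x
    rw [intervalIntegral.integral_const_mul] at h
    simp only [pow_zero, Nat.factorial_zero, Nat.cast_one, div_one, one_mul, add_zero, zero_add]
    rw [← h, Nat.factorial_succ]
    have : ((n + j).factorial : ℝ) ≠ 0 := by positivity
    have : (n : ℝ) + j + 1 ≠ 0 := by positivity
    push_cast
    field_simp
    ring
  | succ s ih =>
    set a := α + (s + 1 : ℕ)
    have ha : α + (s + 1 + 1 : ℕ) = a + 1 := by simp only [a]; push_cast; ring
    have hu : ∀ v : ℝ, HasDerivAt (fun v : ℝ => (x - v) ^ (s + 1) / ((s + 1).factorial : ℝ))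
        (-((x - v) ^ s / (s.factorial : ℝ))) v := fun v => by
      refine ((((hasDerivAt_id v).const_sub x).fun_pow (s + 1)).div_const _).congr_deriv ?_
      rw [Nat.factorial_succ]
      have : (s.factorial : ℝ) ≠ 0 := by positivity
      have : (s : ℝ) + 1 ≠ 0 := by positivity
      push_cast
      simp only [id]
      field_simp
    have hparts := intervalIntegral.integral_mul_deriv_eq_deriv_mul (a := -1) (b := x)
      (fun v _ => hu v) (fun v _ => hasDerivAt_one_add_pow_mul_jacobiP a j n v)
      (Continuous.intervalIntegrable (by fun_prop) _ _)
      (Continuous.intervalIntegrable (by have := continuous_jacobiP (a + 1) j n; fun_prop) _ _)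
    have h1 := ih (j + 1)
    simp only [neg_mul, intervalIntegral.integral_neg, sub_self, ne_eq, Nat.add_eq_zero_iff,
      one_ne_zero, and_false, not_false_eq_true, zero_pow, zero_div, zero_mul, add_neg_cancel,
      mul_zero, zero_sub, neg_neg, h1] at hparts
    have hne : (n : ℝ) + (j + 1 : ℕ) ≠ 0 := by positivity
    rw [ha]
    have e : j + (s + 1) + 1 = j + 1 + s + 1 := by omega
    have e' : n + j + (s + 1) + 1 = n + (j + 1) + s + 1 := by omega
    rw [e, e']
    have hf : ((n + (j + 1)).factorial : ℝ) = (n + (j + 1 : ℕ)) * (n + j).factorial := by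
      rw [← add_assoc, Nat.factorial_succ]; push_cast; ring
    rw [hf] at hparts
    refine mul_left_cancel₀ hne ?_
    rw [← intervalIntegral.integral_const_mul]
    calc _ = _ := by
          refine intervalIntegral.integral_congr fun v _ => ?_
          ring
      _ = _ := hparts
      _ = _ := by ring

lemma poch_neg_natCast (n s : ℕ) (h : s ≤ n) :
    poch (-(n : ℝ)) s * ((n - s).factorial : ℝ) = (-1) ^ s * n.factorial := by
  induction s with
  | zero => simp [poch_zero]
  | succ s ih =>
    have h1 : n - s = n - (s + 1) + 1 := by omega
    have h2 := ih (by omega)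
    rw [h1, Nat.factorial_succ] at h2
    have h3 : ((n - (s + 1) + 1 : ℕ) : ℝ) = n - s := by
      rw [← h1, Nat.cast_sub (by omega)]
    push_cast at h2 h3
    rw [poch_succ_right, pow_succ]
    rw [h3] at h2
    linear_combination -h2

lemma jacobiJ_eq (a : ℝ) {s N : ℕ} (hs : 1 ≤ s) (h : s ≤ N) (t : ℝ) :
    jacobiJ (a + s) 0 s N (1 - 2 * t) =
      (-1) ^ s * 2 ^ s * jacobiA a s (N - s) / poch (-(N : ℝ)) s * (1 - t) ^ s *
        jacobiP a s (N - s) (1 - 2 * t) := by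
  obtain ⟨k, rfl⟩ : ∃ k, N = k + s := ⟨N - s, by omega⟩
  obtain ⟨r, rfl⟩ : ∃ r, s = r + 1 := ⟨s - 1, by omega⟩
  -- The constant `A` depends on the two parameters only through their sum.
  have hA : jacobiA (a + (r + 1 : ℕ)) 0 k = jacobiA a (r + 1 : ℕ) k := by
    simp only [jacobiA]; congr 2; ring
  have h1 := integral_sub_pow_mul_jacobiP a r 0 k (1 - 2 * t)
  have h2 := poch_neg_natCast (k + (r + 1)) (r + 1) (by omega)
  simp only [Nat.add_sub_cancel, pow_zero, one_mul, Nat.cast_zero, add_zero, zero_add] at h1 h2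
  have hk : (k.factorial : ℝ) ≠ 0 := by positivity
  have hn : ((k + (r + 1)).factorial : ℝ) ≠ 0 := by positivity
  have hsgn : ((-1 : ℝ) ^ (r + 1)) ≠ 0 := by simp
  have hp : poch (-((k + (r + 1) : ℕ) : ℝ)) (r + 1) =
      (-1) ^ (r + 1) * (k + (r + 1)).factorial / k.factorial := by
    rw [eq_div_iff hk, h2]
  simp only [jacobiJ, if_neg (show ¬(k + (r + 1) < r + 1) by omega), Nat.add_sub_cancel,
    jacobiHat, hA, hp]
  simp only [mul_left_comm _ (jacobiA _ _ _)]
  rw [intervalIntegral.integral_const_mul, h1, show 1 + (1 - 2 * t) = 2 * (1 - t) by ring, mul_pow,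
    ← add_assoc k r 1]
  rw [← add_assoc k r 1] at hn
  field_simp

lemma sobolevS_eq_coneS (d : ℕ) (β : ℝ) {s n m : ℕ} (hs : 1 ≤ s) (hmn : m ≤ n) (h : s ≤ n - m)
    (Y : MvPolynomial (Fin d) ℝ) (x : EuclideanSpace ℝ (Fin d)) (t : ℝ) :
    sobolevS d β s n m Y x t =
      bConst d β s n m * (1 - t) ^ s * coneS d β s (n - s) m Y x t := by
  have e : n - s - m = n - m - s := by omega
  have hc : (n : ℝ) - m = ((n - m : ℕ) : ℝ) := by rw [Nat.cast_sub hmn]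
  rw [sobolevS, coneS, bConst, jacobiJ_eq _ hs h, e, hc]
  ring

lemma sobolevS_of_lt (d : ℕ) (β : ℝ) {s n m : ℕ} (h : n - m < s)
    (Y : MvPolynomial (Fin d) ℝ) (x : EuclideanSpace ℝ (Fin d)) (t : ℝ) :
    sobolevS d β s n m Y x t =
      2 ^ (n - m) / ((n - m).factorial : ℝ) * (1 - t) ^ (n - m) * evalX Y x := by
  rw [sobolevS, jacobiJ, if_pos h, show 1 - 2 * t + 1 = 2 * (1 - t) by ring, mul_pow]
  ring

/-! ### Harmonic decomposition of polynomials -/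

section Fischer

open MvPolynomial

variable {d : ℕ}

lemma laplacian_apply (p : MvPolynomial (Fin d) ℝ) :
    laplacian d p = ∑ i, pderiv i (pderiv i p) := by
  simp [laplacian]

/-- The polynomial `‖x‖² = x_1² + ⋯ + x_d²`. -/
def normSq (d : ℕ) : MvPolynomial (Fin d) ℝ := ∑ i, X i ^ 2

lemma isHomogeneous_normSq : (normSq d).IsHomogeneous 2 :=
  IsHomogeneous.sum _ _ _ fun i _ => isHomogeneous_X_pow i 2

lemma pderiv_normSq (i : Fin d) : pderiv i (normSq d) = 2 * X i := by
  classical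
  simp only [normSq, map_sum, pderiv_pow, pderiv_X, Pi.single_apply]
  simp

lemma normSq_ne_zero (hd : 1 ≤ d) : normSq d ≠ 0 := by
  intro h
  have := congrArg (eval (fun _ => (1 : ℝ))) h
  simp [normSq] at this
  omega

lemma isHomogeneous_laplacian {p : MvPolynomial (Fin d) ℝ} {k : ℕ} (hp : p.IsHomogeneous k) :
    (laplacian d p).IsHomogeneous (k - 2) := by
  rw [laplacian_apply]
  exact IsHomogeneous.sum _ _ _ fun i _ => hp.pderiv.pderiv

/-- Leibniz rule, with Euler's identity `∑ x_i ∂_i g = k g` for the cross term. -/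
lemma laplacian_normSq_mul {g : MvPolynomial (Fin d) ℝ} {k : ℕ} (hg : g.IsHomogeneous k) :
    laplacian d (normSq d * g) = C (2 * d + 4 * k : ℝ) * g + normSq d * laplacian d g := by
  have h : ∀ i : Fin d, pderiv i (pderiv i (normSq d * g)) =
      2 * g + 4 * (X i * pderiv i g) + normSq d * pderiv i (pderiv i g) := fun i => by
    simp only [pderiv_mul, pderiv_normSq, map_add, pderiv_X_self]
    have : pderiv i (2 : MvPolynomial (Fin d) ℝ) = 0 := by
      rw [show (2 : MvPolynomial (Fin d) ℝ) = C 2 from (map_ofNat C 2).symm, pderiv_C]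
    rw [this]
    ring
  have he := hg.sum_X_mul_pderiv
  simp only [laplacian_apply, h, Finset.sum_add_distrib, ← Finset.mul_sum, he]
  simp only [Finset.sum_const, Finset.card_univ, Fintype.card_fin, nsmul_eq_mul, map_add, map_mul,
    map_ofNat, map_natCast]
  ring

lemma laplacian_normSq_pow_mul {g : MvPolynomial (Fin d) ℝ} {k : ℕ} (hg : g.IsHomogeneous k)
    (j : ℕ) :
    laplacian d (normSq d ^ (j + 1) * g) =
      C (2 * (j + 1) * (d + 2 * j + 2 * k) : ℝ) * (normSq d ^ j * g) +
        normSq d ^ (j + 1) * laplacian d g := by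
  induction j with
  | zero =>
    simp only [zero_add, pow_one, pow_zero, one_mul, laplacian_normSq_mul hg]
    congr 3
    push_cast
    ring
  | succ j ih =>
    have hh : (normSq d ^ (j + 1) * g).IsHomogeneous (2 * (j + 1) + k) :=
      (isHomogeneous_normSq.pow (j + 1)).mul hg
    rw [pow_succ', mul_assoc, laplacian_normSq_mul hh, ih]
    simp only [map_add, map_mul, map_ofNat, map_natCast, map_one]
    push_cast
    ring

/-- The hypothesis gives `c g = -‖x‖² Δg` with `c > 0`. Hence `‖x‖^(2(j+2)) Δg` is a multiple of the
harmonic polynomial `‖x‖^(2(j+1)) g`, and induction on the degree gives `Δg = 0`, so `g = 0`.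
Arbitrary powers of `‖x‖²` are admitted so that the induction closes. -/
lemma eq_zero_of_laplacian_normSq_pow_mul_eq_zero (hd : 1 ≤ d) {k : ℕ} :
    ∀ {g : MvPolynomial (Fin d) ℝ}, g.IsHomogeneous k → ∀ j : ℕ,
      laplacian d (normSq d ^ (j + 1) * g) = 0 → g = 0 := by
  induction k using Nat.strong_induction_on with
  | _ k ih =>
    intro g hg j h
    have hc : (2 * (j + 1) * (d + 2 * j + 2 * k) : ℝ) ≠ 0 := by
      have : (1 : ℝ) ≤ d := by exact_mod_cast hd
      positivity
    set c : ℝ := 2 * (j + 1) * (d + 2 * j + 2 * k) with hcdef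
    have h0 := h
    rw [laplacian_normSq_pow_mul hg] at h0
    have h1 : C c * g + normSq d * laplacian d g = 0 := by
      refine (mul_eq_zero.mp ?_).resolve_left (pow_ne_zero j (normSq_ne_zero hd))
      rw [← h0]
      ring
    have hg' : g = C (-c⁻¹) * (normSq d * laplacian d g) := by
      have h2 : C c⁻¹ * (C c * g) = g := by
        rw [← mul_assoc, ← C_mul, inv_mul_cancel₀ hc, C_1, one_mul]
      rw [map_neg]
      linear_combination C c⁻¹ * h1 - h2
    -- For `k < 2` the truncated degree `k - 2` is `0`, so the right side of `hg'` is homogeneous of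
    -- degree `2 ≠ k`, which forces `g = 0`.
    by_cases hk : k < 2
    · by_contra hne
      have h3 : g.IsHomogeneous (2 + (k - 2)) := by
        rw [hg']
        exact (isHomogeneous_normSq.mul (isHomogeneous_laplacian hg)).C_mul _
      have := hg.inj_right h3 hne
      omega
    · have h3 : laplacian d g = 0 := by
        refine ih (k - 2) (by omega) (isHomogeneous_laplacian hg) (j + 1) ?_
        have : normSq d ^ (j + 1 + 1) * laplacian d g = (-c) • (normSq d ^ (j + 1) * g) := by
          rw [smul_eq_C_mul, map_neg]
          linear_combination (normSq d ^ (j + 1)) * h1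
        rw [this, map_smul, h, smul_zero]
      rw [hg', h3, mul_zero, mul_zero]

/-- Every homogeneous polynomial of degree `m + 2` is the sum of a solid harmonic and of a multiple
of `‖x‖²`. -/
lemma exists_eq_add_normSq_mul (hd : 1 ≤ d) {m : ℕ} {p : MvPolynomial (Fin d) ℝ}
    (hp : p.IsHomogeneous (m + 2)) :
    ∃ h ∈ solidHarmonics d (m + 2), ∃ q : MvPolynomial (Fin d) ℝ, q.IsHomogeneous m ∧
      p = h + normSq d * q := by
  have : FiniteDimensional ℝ (homogeneousSubmodule (Fin d) ℝ m) :=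
    Module.Finite.iff_fg.mpr (homogeneousSubmodule_fg _ _ m)
  -- The endomorphism `q ↦ Δ(‖x‖² q)` of a finite-dimensional space is injective, hence surjective.
  -- A `q` with `Δ(‖x‖² q) = Δp` makes `p - ‖x‖² q` harmonic.
  let T : homogeneousSubmodule (Fin d) ℝ m →ₗ[ℝ] homogeneousSubmodule (Fin d) ℝ m :=
    LinearMap.restrict (laplacian d ∘ₗ LinearMap.mulLeft ℝ (normSq d)) fun q hq => by
      have := isHomogeneous_laplacian (isHomogeneous_normSq.mul
        ((mem_homogeneousSubmodule m q).mp hq))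
      rw [Nat.add_sub_cancel_left] at this
      exact this
  have hT : Function.Injective T := by
    rw [← LinearMap.ker_eq_bot, LinearMap.ker_eq_bot']
    rintro ⟨q, hq⟩ h
    have h' : laplacian d (normSq d * q) = 0 := congrArg Subtype.val h
    exact Subtype.ext (eq_zero_of_laplacian_normSq_pow_mul_eq_zero hd hq 0 (by simpa using h'))
  obtain ⟨⟨q, hq⟩, hqT⟩ := LinearMap.injective_iff_surjective.mp hT
    ⟨laplacian d p, isHomogeneous_laplacian hp⟩
  have hqT' : laplacian d (normSq d * q) = laplacian d p := congrArg Subtype.val hqT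
  refine ⟨p - normSq d * q, ⟨?_, ?_⟩, q, hq, by ring⟩
  · refine hp.sub ?_
    rw [add_comm]
    exact isHomogeneous_normSq.mul hq
  · simp [hqT']

end Fischer

/-! ### Orthogonality of solid harmonics of different degrees -/

section Gaussian

open MvPolynomial

variable {d : ℕ}

@[simp] lemma evalX_add (p q : MvPolynomial (Fin d) ℝ) (x : EuclideanSpace ℝ (Fin d)) :
    evalX (p + q) x = evalX p x + evalX q x := by simp [evalX]

@[simp] lemma evalX_mul (p q : MvPolynomial (Fin d) ℝ) (x : EuclideanSpace ℝ (Fin d)) :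
    evalX (p * q) x = evalX p x * evalX q x := by simp [evalX]

@[simp] lemma evalX_C (c : ℝ) (x : EuclideanSpace ℝ (Fin d)) :
    evalX (C c) x = c := by simp [evalX]

@[simp] lemma evalX_X (i : Fin d) (x : EuclideanSpace ℝ (Fin d)) :
    evalX (X i) x = x i := by simp [evalX]

lemma continuous_evalX (p : MvPolynomial (Fin d) ℝ) : Continuous (evalX p) := by
  unfold evalX
  exact (MvPolynomial.continuous_eval p).comp (by fun_prop)

lemma evalX_smul_of_isHomogeneous {p : MvPolynomial (Fin d) ℝ} {k : ℕ} (hp : p.IsHomogeneous k)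
    (t : ℝ) (x : EuclideanSpace ℝ (Fin d)) : evalX p (t • x) = t ^ k * evalX p x := by
  simp only [evalX, eval_eq, Finset.mul_sum]
  refine Finset.sum_congr rfl fun m hm => ?_
  have hk : m.degree = k := by
    by_contra h
    exact (mem_support_iff.mp hm) (hp.coeff_eq_zero h)
  simp only [PiLp.smul_apply, smul_eq_mul, mul_pow, Finset.prod_mul_distrib,
    Finset.prod_pow_eq_pow_sum]
  rw [show ∑ i ∈ m.support, m i = k from hk]
  ring

lemma hasLineDerivAt_evalX (p : MvPolynomial (Fin d) ℝ) (i : Fin d)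
    (x : EuclideanSpace ℝ (Fin d)) :
    HasLineDerivAt ℝ (evalX p) (evalX (pderiv i p) x) x (EuclideanSpace.single i 1) := by
  classical
  induction p using MvPolynomial.induction_on with
  | C a => simpa [HasLineDerivAt, evalX] using hasDerivAt_const (0 : ℝ) a
  | add p q hp hq =>
    simpa [HasLineDerivAt] using HasDerivAt.fun_add hp hq
  | mul_X p j hp =>
    have hj : HasDerivAt (fun t : ℝ => (x + t • EuclideanSpace.single i (1 : ℝ)) j)
        (Pi.single (M := fun _ => ℝ) i 1 j) 0 := by
      simp only [PiLp.add_apply, PiLp.smul_apply, PiLp.single_apply, Pi.single_apply,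
        smul_eq_mul]
      simpa using ((hasDerivAt_id (0 : ℝ)).mul_const (if j = i then (1 : ℝ) else 0)).const_add (x j)
    have h := HasDerivAt.fun_mul hp hj
    simp only [HasLineDerivAt, evalX_mul, evalX_X]
    refine h.congr_deriv ?_
    simp only [zero_smul, add_zero, pderiv_mul, evalX_add, evalX_mul, evalX_X, pderiv_X,
      Pi.single_apply]
    split_ifs <;> simp [evalX]

lemma hasLineDerivAt_gaussian (i : Fin d) (x : EuclideanSpace ℝ (Fin d)) :
    HasLineDerivAt ℝ (fun y : EuclideanSpace ℝ (Fin d) => Real.exp (-‖y‖ ^ 2))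
      (-(2 * x i * Real.exp (-‖x‖ ^ 2))) x (EuclideanSpace.single i 1) := by
  have hn : ∀ t : ℝ, ‖x + t • EuclideanSpace.single i (1 : ℝ)‖ ^ 2 =
      ‖x‖ ^ 2 + 2 * t * x i + t ^ 2 := fun t => by
    rw [norm_add_sq_real, inner_smul_right, norm_smul, EuclideanSpace.inner_single_right]
    simp
    ring
  simp only [HasLineDerivAt, hn]
  have h1 : HasDerivAt (fun t : ℝ => -(‖x‖ ^ 2 + 2 * t * x i + t ^ 2)) (-(2 * x i)) 0 := by
    have h2 : HasDerivAt (fun t : ℝ => 2 * t * x i) (2 * 1 * x i) 0 :=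
      ((hasDerivAt_id (0 : ℝ)).const_mul 2).mul_const (x i)
    have h3 := ((h2.const_add (‖x‖ ^ 2)).add (hasDerivAt_pow 2 (0 : ℝ))).neg
    exact h3.congr_deriv (by simp)
  exact h1.exp.congr_deriv (by simp; ring)

/-! ### Integration of polynomials against the Gaussian. -/

lemma exists_abs_evalX_le (p : MvPolynomial (Fin d) ℝ) :
    ∀ ε : ℝ, 0 < ε → ∃ C : ℝ, 0 ≤ C ∧ ∀ x, |evalX p x| ≤ C * Real.exp (ε * ‖x‖ ^ 2) := by
  induction p using MvPolynomial.induction_on with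
  | C a =>
    refine fun ε hε => ⟨|a|, abs_nonneg a, fun x => ?_⟩
    rw [evalX_C]
    exact le_mul_of_one_le_right (abs_nonneg a) (Real.one_le_exp (by positivity))
  | add p q hp hq =>
    intro ε hε
    obtain ⟨A, hA, hA'⟩ := hp ε hε
    obtain ⟨B, hB, hB'⟩ := hq ε hε
    refine ⟨A + B, add_nonneg hA hB, fun x => ?_⟩
    rw [evalX_add, add_mul]
    exact (abs_add_le _ _).trans (add_le_add (hA' x) (hB' x))
  | mul_X p j hp =>
    intro ε hε
    have hε2 : 0 < ε / 2 := by positivity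
    -- Half of the exponent is spent on `p`, half on the linear factor; this is why the bound is
    -- proved for every `ε`.
    obtain ⟨A, hA, hA'⟩ := hp (ε / 2) hε2
    refine ⟨A * (1 + 1 / (ε / 2)), by positivity, fun x => ?_⟩
    have h1 : |x j| ≤ ‖x‖ := by simpa using PiLp.norm_apply_le x j
    have h2 : ‖x‖ ≤ (1 + 1 / (ε / 2)) * Real.exp (ε / 2 * ‖x‖ ^ 2) := by
      have h3 := Real.add_one_le_exp (ε / 2 * ‖x‖ ^ 2)
      have h4 : ‖x‖ ≤ 1 + ‖x‖ ^ 2 := by nlinarith [sq_nonneg (‖x‖ - 1), norm_nonneg x]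
      refine h4.trans (le_trans ?_ (mul_le_mul_of_nonneg_left h3 (by positivity)))
      have : (1 + 1 / (ε / 2)) * (ε / 2 * ‖x‖ ^ 2 + 1) =
          1 + ‖x‖ ^ 2 + (ε / 2 * ‖x‖ ^ 2 + 1 / (ε / 2)) := by
        field_simp
        ring
      rw [this]
      have : 0 ≤ ε / 2 * ‖x‖ ^ 2 + 1 / (ε / 2) := by positivity
      linarith
    rw [evalX_mul, evalX_X, abs_mul]
    calc _ ≤ (A * Real.exp (ε / 2 * ‖x‖ ^ 2)) *
          ((1 + 1 / (ε / 2)) * Real.exp (ε / 2 * ‖x‖ ^ 2)) :=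
          mul_le_mul (hA' x) (h1.trans h2) (abs_nonneg _) (by positivity)
      _ = A * (1 + 1 / (ε / 2)) * (Real.exp (ε / 2 * ‖x‖ ^ 2) * Real.exp (ε / 2 * ‖x‖ ^ 2)) := by
          ring
      _ = _ := by
          rw [← Real.exp_add]
          congr 2
          ring

lemma integrable_evalX_mul_gaussian (p : MvPolynomial (Fin d) ℝ) :
    Integrable fun x : EuclideanSpace ℝ (Fin d) => evalX p x * Real.exp (-‖x‖ ^ 2) := by
  obtain ⟨A, hA, hA'⟩ := exists_abs_evalX_le p (1 / 2) (by norm_num)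
  have hg : Integrable fun x : EuclideanSpace ℝ (Fin d) => Real.exp (-(1 / 2) * ‖x‖ ^ 2) := by
    have h := GaussianFourier.integrable_cexp_neg_mul_sq_norm_add (V := EuclideanSpace ℝ (Fin d))
      (b := (1 / 2 : ℝ)) (by norm_num) 0 0
    refine h.norm.congr (Filter.Eventually.of_forall fun x => ?_)
    simp only [Complex.norm_exp]
    congr 1
    simp [← Complex.ofReal_pow]
  refine (hg.const_mul A).mono' ?_ (Filter.Eventually.of_forall fun x => ?_)
  · exact ((continuous_evalX p).mul (by fun_prop)).aestronglyMeasurable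
  · rw [Real.norm_eq_abs, abs_mul, abs_of_pos (Real.exp_pos _)]
    calc _ ≤ A * Real.exp (1 / 2 * ‖x‖ ^ 2) * Real.exp (-‖x‖ ^ 2) :=
          mul_le_mul_of_nonneg_right (hA' x) (Real.exp_pos _).le
      _ = _ := by
          rw [mul_assoc, ← Real.exp_add]
          congr 2
          ring

/-- The integral of a polynomial against the Gaussian `exp (-‖x‖²)`. -/
def gaussianIntegral (p : MvPolynomial (Fin d) ℝ) : ℝ :=
  ∫ x : EuclideanSpace ℝ (Fin d), evalX p x * Real.exp (-‖x‖ ^ 2)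

lemma gaussianIntegral_add (p q : MvPolynomial (Fin d) ℝ) :
    gaussianIntegral (p + q) = gaussianIntegral p + gaussianIntegral q := by
  simp only [gaussianIntegral, evalX_add, add_mul]
  exact integral_add (integrable_evalX_mul_gaussian p) (integrable_evalX_mul_gaussian q)

lemma gaussianIntegral_C_mul (c : ℝ) (p : MvPolynomial (Fin d) ℝ) :
    gaussianIntegral (C c * p) = c * gaussianIntegral p := by
  simp only [gaussianIntegral, evalX_mul, evalX_C, mul_assoc]
  exact integral_const_mul _ _

lemma gaussianIntegral_sum {ι : Type*} (s : Finset ι) (p : ι → MvPolynomial (Fin d) ℝ) :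
    gaussianIntegral (∑ i ∈ s, p i) = ∑ i ∈ s, gaussianIntegral (p i) :=
  map_sum (AddMonoidHom.mk' gaussianIntegral gaussianIntegral_add) p s

lemma gaussianIntegral_pderiv (i : Fin d) (p : MvPolynomial (Fin d) ℝ) :
    gaussianIntegral (pderiv i p) = 2 * gaussianIntegral (X i * p) := by
  have h := integral_bilinear_hasLineDerivAt_right_eq_neg_left_of_integrable
    (μ := (volume : Measure (EuclideanSpace ℝ (Fin d)))) (B := ContinuousLinearMap.mul ℝ ℝ)
    (f := evalX p) (f' := evalX (pderiv i p))
    (g := fun y : EuclideanSpace ℝ (Fin d) => Real.exp (-‖y‖ ^ 2))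
    (g' := fun x => -(2 * x i * Real.exp (-‖x‖ ^ 2))) (v := EuclideanSpace.single i 1)
    (by simpa using integrable_evalX_mul_gaussian (pderiv i p))
    (by
      refine (integrable_evalX_mul_gaussian (C (-2) * (X i * p))).congr
        (Filter.Eventually.of_forall fun x => ?_)
      simp only [evalX_mul, evalX_C, evalX_X, ContinuousLinearMap.mul_apply']
      ring)
    (by simpa using integrable_evalX_mul_gaussian p)
    (fun x _ => hasLineDerivAt_evalX p i x) (fun x _ => hasLineDerivAt_gaussian i x)
  simp only [ContinuousLinearMap.mul_apply'] at h
  rw [← gaussianIntegral_C_mul]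
  have h2 : ∫ x : EuclideanSpace ℝ (Fin d), evalX p x * -(2 * x i * Real.exp (-‖x‖ ^ 2)) =
      - gaussianIntegral (C 2 * (X i * p)) := by
    rw [gaussianIntegral, ← integral_neg]
    refine integral_congr_ae (Filter.Eventually.of_forall fun x => ?_)
    simp
    ring
  rw [h2] at h
  exact (neg_injective h).symm

/-- Integrating `div (p ∇q)` against the Gaussian by parts, with `Δq = 0` and Euler's identity. The
left side is symmetric in `p` and `q`, while the right side sees the degree of `q`; for harmonics of
different degrees this forces `∫ p q = 0`. -/
lemma gaussianIntegral_gradient {p q : MvPolynomial (Fin d) ℝ} {k : ℕ}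
    (hq : q ∈ solidHarmonics d k) :
    gaussianIntegral (∑ i, pderiv i p * pderiv i q) = 2 * k * gaussianIntegral (p * q) := by
  have h1 : ∀ i, gaussianIntegral (pderiv i p * pderiv i q) +
      gaussianIntegral (p * pderiv i (pderiv i q)) =
        2 * gaussianIntegral (p * (X i * pderiv i q)) := fun i => by
    rw [← gaussianIntegral_add, mul_left_comm p (X i), ← gaussianIntegral_pderiv, pderiv_mul]
  have h2 := Finset.sum_congr (rfl : (Finset.univ : Finset (Fin d)) = Finset.univ) fun i _ => h1 i
  have hlap : ∑ i, pderiv i (pderiv i q) = 0 := by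
    rw [← laplacian_apply]
    exact hq.2
  have hE : ∑ i, X i * pderiv i q = C (k : ℝ) * q := by
    rw [IsHomogeneous.sum_X_mul_pderiv hq.1, nsmul_eq_mul, map_natCast]
  rw [Finset.sum_add_distrib, ← Finset.mul_sum, ← gaussianIntegral_sum, ← gaussianIntegral_sum,
    ← gaussianIntegral_sum, ← Finset.mul_sum, ← Finset.mul_sum, hlap, hE, mul_zero,
    mul_left_comm, gaussianIntegral_C_mul] at h2
  have h0 : gaussianIntegral (0 : MvPolynomial (Fin d) ℝ) = 0 := by simp [gaussianIntegral, evalX]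
  rw [h0] at h2
  linarith

/-- Polar coordinates: for homogeneous `p` the radial factor splits off as a Gamma integral. Only
its positivity matters for passing orthogonality from the Gaussian to the sphere. -/
lemma gaussianIntegral_eq_sphereIntegral (hd : 1 ≤ d) {p : MvPolynomial (Fin d) ℝ} {k : ℕ}
    (hp : p.IsHomogeneous k) :
    ∃ c : ℝ, 0 < c ∧ gaussianIntegral p = c * sphereIntegral d (evalX p) := by
  have : NeZero d := ⟨by omega⟩
  let E := EuclideanSpace ℝ (Fin d)
  refine ⟨∫ r : Set.Ioi (0 : ℝ), (r : ℝ) ^ k * Real.exp (-(r : ℝ) ^ 2)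
    ∂(Measure.volumeIoiPow (Module.finrank ℝ E - 1)), ?_, ?_⟩
  · have h1 : ∫ r : Set.Ioi (0 : ℝ), (r : ℝ) ^ k * Real.exp (-(r : ℝ) ^ 2)
        ∂(Measure.volumeIoiPow (Module.finrank ℝ E - 1)) =
        ∫ r in Set.Ioi (0 : ℝ), r ^ ((Module.finrank ℝ E - 1 + k : ℕ) : ℝ) *
          Real.exp (-r ^ (2 : ℝ)) := by
      simp only [Measure.volumeIoiPow, ENNReal.ofReal]
      rw [integral_withDensity_eq_integral_smul,
        integral_subtype_comap measurableSet_Ioi fun a : ℝ =>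
          Real.toNNReal (a ^ (Module.finrank ℝ E - 1)) • (a ^ k * Real.exp (-a ^ 2))]
      · refine setIntegral_congr_fun measurableSet_Ioi fun x hx => ?_
        have hx0 : (0 : ℝ) ≤ x := le_of_lt hx
        simp only [NNReal.smul_def, Real.coe_toNNReal _ (pow_nonneg hx0 _), Real.rpow_natCast,
          Real.rpow_ofNat, smul_eq_mul, pow_add]
        ring
      · exact (measurable_subtype_coe.pow_const _).real_toNNReal
    rw [h1, integral_rpow_mul_exp_neg_rpow (by norm_num) (by
      have : (0 : ℝ) ≤ ((Module.finrank ℝ E - 1 + k : ℕ) : ℝ) := Nat.cast_nonneg _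
      linarith)]
    have : 0 < Real.Gamma ((((Module.finrank ℝ E - 1 + k : ℕ) : ℝ) + 1) / 2) :=
      Real.Gamma_pos_of_pos (by positivity)
    positivity
  · have h := (volume : Measure E).measurePreserving_homeomorphUnitSphereProd.integral_comp
      (Homeomorph.measurableEmbedding _)
      (fun z => evalX p (z.1 : E) * ((z.2 : ℝ) ^ k * Real.exp (-(z.2 : ℝ) ^ 2)))
    rw [integral_prod_mul (fun ξ : Metric.sphere (0 : E) 1 => evalX p (ξ : E))
      (fun r : Set.Ioi (0 : ℝ) => (r : ℝ) ^ k * Real.exp (-(r : ℝ) ^ 2)), mul_comm] at h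
    have h0 : gaussianIntegral p = ∫ x : ({(0)}ᶜ : Set E), evalX p (x : E) *
        Real.exp (-‖(x : E)‖ ^ 2) ∂((volume : Measure E).comap (↑)) := by
      rw [integral_subtype_comap (measurableSet_singleton _).compl
        fun x : E => evalX p x * Real.exp (-‖x‖ ^ 2), restrict_compl_singleton, gaussianIntegral]
    rw [sphereIntegral, sphereMeasure, ← h, h0]
    refine integral_congr_ae (Filter.Eventually.of_forall fun x => ?_)
    have hx : ‖(x : E)‖ ≠ 0 := norm_ne_zero_iff.mpr x.2
    simp only [homeomorphUnitSphereProd_apply_fst_coe, homeomorphUnitSphereProd_apply_snd_coe]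
    rw [evalX_smul_of_isHomogeneous hp, inv_pow]
    field_simp

/-- Solid harmonics of different degrees are orthogonal on the unit sphere. -/
lemma sphereIntegral_mul_eq_zero (hd : 1 ≤ d) {m k : ℕ} (hmk : m ≠ k)
    {p q : MvPolynomial (Fin d) ℝ} (hp : p ∈ solidHarmonics d m) (hq : q ∈ solidHarmonics d k) :
    sphereIntegral d (fun ξ => evalX p ξ * evalX q ξ) = 0 := by
  have h1 := gaussianIntegral_gradient (p := p) hq
  have h2 := gaussianIntegral_gradient (p := q) hp
  simp only [mul_comm (pderiv _ q), mul_comm q p] at h2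
  have h3 : ((m : ℝ) - k) * gaussianIntegral (p * q) = 0 := by linarith
  have h4 : gaussianIntegral (p * q) = 0 :=
    (mul_eq_zero.mp h3).resolve_left (sub_ne_zero.mpr (by exact_mod_cast hmk))
  obtain ⟨c, hc, h5⟩ := gaussianIntegral_eq_sphereIntegral hd
    (IsHomogeneous.mul (show p.IsHomogeneous m from hp.1) (show q.IsHomogeneous k from hq.1))
  rw [h4, zero_eq_mul] at h5
  have h6 := h5.resolve_left hc.ne'
  rw [← h6]
  congr 1
  ext ξ
  simp

end Gaussian

/-! ### Sobolev orthogonality in one variable -/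

section OneVariable

open Polynomial

/-- The functional `p ↦ ∫_0^1 t^α p(t) dt`, given by the moments `1 / (α + i + 1)`. -/
def moment (α : ℝ) : ℝ[X] →ₗ[ℝ] ℝ :=
  Polynomial.lsum fun i => (α + i + 1)⁻¹ • LinearMap.id

lemma moment_monomial (α : ℝ) (i : ℕ) (a : ℝ) : moment α (monomial i a) = (α + i + 1)⁻¹ * a := by
  simp [moment, Polynomial.lsum_apply]

/-- Through this bridge every integral in `t` becomes a linear functional, and later identities need
checking only on monomials. -/
lemma integral_rpow_mul_eval {α : ℝ} (hα : -1 < α) (p : ℝ[X]) :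
    IntervalIntegrable (fun t : ℝ => t ^ α * p.eval t) volume 0 1 ∧
      ∫ t in (0 : ℝ)..1, t ^ α * p.eval t = moment α p := by
  induction p using Polynomial.induction_on' with
  | add p q hp hq =>
    simp only [eval_add, mul_add, map_add]
    exact ⟨hp.1.add hq.1, by rw [intervalIntegral.integral_add hp.1 hq.1, hp.2, hq.2]⟩
  | monomial i a =>
    have hi : -1 < α + i := by
      have : (0 : ℝ) ≤ i := Nat.cast_nonneg i
      linarith
    have he : Set.EqOn (fun t : ℝ => a * t ^ (α + i)) (fun t : ℝ => t ^ α * (monomial i a).eval t)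
        (Set.uIoc 0 1) := by
      rw [Set.uIoc_of_le zero_le_one]
      intro t ht
      simp only [eval_monomial, Real.rpow_add ht.1, Real.rpow_natCast]
      ring
    refine ⟨((intervalIntegral.intervalIntegrable_rpow' hi).const_mul a).congr he, ?_⟩
    rw [← intervalIntegral.integral_congr_ae (Filter.Eventually.of_forall he), intervalIntegral.integral_const_mul,
      integral_rpow (Or.inl hi), moment_monomial, Real.one_rpow,
      Real.zero_rpow (by linarith)]
    ring

lemma moment_X_mul (α : ℝ) (p : ℝ[X]) : moment α (X * p) = moment (α + 1) p := by
  induction p using Polynomial.induction_on' with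
  | add p q hp hq => rw [mul_add, map_add, hp, hq, map_add]
  | monomial i a =>
    rw [X_mul_monomial, moment_monomial, moment_monomial]
    congr 2
    push_cast
    ring

/-- The fundamental theorem of calculus for `t^(α+1) p(t)`, which has no boundary term at `0` as `α
+ 1 > 0`. -/
lemma moment_derivative {α : ℝ} (hα : -1 < α) (p : ℝ[X]) :
    moment (α + 1) (derivative p) + (α + 1) * moment α p = p.eval 1 := by
  induction p using Polynomial.induction_on' with
  | add p q hp hq =>
    simp only [map_add, eval_add, ← hp, ← hq]
    ring
  | monomial i a =>
    cases i with
    | zero =>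
      have : α + 1 ≠ 0 := by linarith
      rw [derivative_monomial, moment_monomial, moment_monomial]
      simp [this]
    | succ i =>
      have h0 : α + 1 + i + 1 ≠ 0 := by
        have : (0 : ℝ) ≤ i := Nat.cast_nonneg i
        linarith
      have h1 : α + (i + 1 : ℕ) + 1 = α + 1 + i + 1 := by push_cast; ring
      rw [derivative_monomial, Nat.add_sub_cancel, moment_monomial, moment_monomial, h1,
        eval_monomial, one_pow]
      push_cast
      field_simp
      ring

/-- The diagonal operator `∑ a_i X^i ↦ ∑ c_i a_i X^i`. -/
def diagonal (c : ℕ → ℝ) : ℝ[X] →ₗ[ℝ] ℝ[X] :=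
  Polynomial.lsum fun i => c i • monomial i

lemma coeff_diagonal (c : ℕ → ℝ) (p : ℝ[X]) (n : ℕ) :
    (diagonal c p).coeff n = c n * p.coeff n := by
  induction p using Polynomial.induction_on' with
  | add p q hp hq => rw [map_add, coeff_add, hp, hq, coeff_add, mul_add]
  | monomial i a =>
    simp only [diagonal, Polynomial.lsum_apply, LinearMap.smul_apply]
    rw [sum_monomial_index _ _ (by simp)]
    by_cases h : i = n
    · subst h; simp
    · simp [coeff_monomial, h]

lemma mem_degreeLT_iff_coeff {p : ℝ[X]} {n : ℕ} :
    p ∈ degreeLT ℝ n ↔ ∀ m, n ≤ m → p.coeff m = 0 := by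
  rw [mem_degreeLT, degree_lt_iff_coeff_zero]

lemma diagonal_mem_degreeLT (c : ℕ → ℝ) {p : ℝ[X]} {n : ℕ} (hp : p ∈ degreeLT ℝ n) :
    diagonal c p ∈ degreeLT ℝ n := by
  rw [mem_degreeLT_iff_coeff] at hp ⊢
  intro m hm
  rw [coeff_diagonal, hp m hm, mul_zero]

lemma iterate_derivative_mem_degreeLT {p : ℝ[X]} {n : ℕ} (hp : p ∈ degreeLT ℝ n) (k : ℕ) :
    derivative^[k] p ∈ degreeLT ℝ (n - k) := by
  rw [mem_degreeLT_iff_coeff] at hp ⊢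
  intro m hm
  rw [coeff_iterate_derivative, hp _ (by omega), smul_zero]

lemma iterate_derivative_eq_zero_of_mem_degreeLT {p : ℝ[X]} {n k : ℕ} (hp : p ∈ degreeLT ℝ n)
    (hk : n ≤ k) : derivative^[k] p = 0 := by
  have h := iterate_derivative_mem_degreeLT hp k
  rw [Nat.sub_eq_zero_of_le hk, mem_degreeLT_iff_coeff] at h
  ext m
  simpa using h m (Nat.zero_le m)

lemma exists_iterate_derivative_eq {g : ℝ[X]} {n : ℕ} (hg : g ∈ degreeLT ℝ n) (k : ℕ) :
    ∃ q ∈ degreeLT ℝ (n + k), derivative^[k] q = g := by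
  induction k with
  | zero => exact ⟨g, hg, rfl⟩
  | succ k ih =>
    obtain ⟨q, hq, rfl⟩ := ih
    -- The antiderivative of `q` without constant term.
    refine ⟨X * diagonal (fun i => ((i : ℝ) + 1)⁻¹) q, ?_, ?_⟩
    · have h := diagonal_mem_degreeLT (fun i => ((i : ℝ) + 1)⁻¹) hq
      rw [mem_degreeLT_iff_coeff] at h ⊢
      rintro (_ | m) hm
      · omega
      · rw [coeff_X_mul]
        exact h m (by omega)
    · rw [Function.iterate_succ_apply]
      congr 1
      ext m
      have : (m : ℝ) + 1 ≠ 0 := by positivity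
      rw [coeff_derivative, coeff_X_mul, coeff_diagonal]
      field_simp

/-- Integration by parts, where the derivative of `t^(α+1) t^i` is `(α+1+i) t^α t^i`. The weight
loses one power of `t` and `g` is acted on diagonally, so its degree does not grow. -/
lemma moment_derivative_mul {α : ℝ} (hα : -1 < α) (f g : ℝ[X]) (hf : f.eval 1 = 0) :
    moment (α + 1) (derivative f * g) = -moment α (f * diagonal (fun i => α + 1 + i) g) := by
  have hD : diagonal (fun i => α + 1 + i) g = C (α + 1) * g + X * derivative g := by
    ext n
    rw [coeff_diagonal, coeff_add, coeff_C_mul]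
    cases n with
    | zero => simp
    | succ n =>
      rw [coeff_X_mul, coeff_derivative]
      push_cast
      ring
  have h := moment_derivative hα (f * g)
  have h1 : f * (C (α + 1) * g + X * derivative g) =
      (α + 1) • (f * g) + X * (f * derivative g) := by
    rw [smul_eq_C_mul]
    ring
  rw [derivative_mul, map_add, eval_mul, hf, zero_mul] at h
  rw [hD, h1, map_add, map_smul, moment_X_mul, smul_eq_mul]
  linarith

lemma moment_iterate_derivative_mul {α : ℝ} (hα : -1 < α) (f : ℝ[X]) (s : ℕ)
    (hf : ∀ k < s, (derivative^[k] f).eval 1 = 0) (g : ℝ[X]) :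
    moment (α + s) (derivative^[s] f * g) =
      (-1) ^ s * moment α (f * diagonal (fun i => poch (α + 1 + i) s) g) := by
  induction s generalizing g with
  | zero =>
    have : diagonal (fun i => poch (α + 1 + i) 0) g = g := by
      ext n
      rw [coeff_diagonal, poch_zero, one_mul]
    simp [this]
  | succ s ih =>
    have hs : -1 < α + s := by
      have : (0 : ℝ) ≤ s := Nat.cast_nonneg s
      linarith
    have h1 : α + (s + 1 : ℕ) = α + s + 1 := by push_cast; ring
    rw [h1, Function.iterate_succ_apply', moment_derivative_mul hs _ _ (hf s s.lt_succ_self),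
      ih fun k hk => hf k (hk.trans s.lt_succ_self)]
    have h2 : diagonal (fun i => poch (α + 1 + i) s) (diagonal (fun i => α + s + 1 + i) g) =
        diagonal (fun i => poch (α + 1 + i) (s + 1)) g := by
      ext n
      simp only [coeff_diagonal, poch_succ_right]
      ring
    rw [h2, pow_succ]
    ring

/-! ### Order of vanishing at `t = 1`. -/

lemma one_sub_X_pow (M : ℕ) : (1 - X : ℝ[X]) ^ M = C ((-1) ^ M) * (X - C 1) ^ M := by
  rw [C_pow, ← mul_pow]
  simp

lemma iterate_derivative_X_sub_one_pow_eval (j k : ℕ) :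
    (derivative^[k] ((X - C 1 : ℝ[X]) ^ j)).eval 1 = if k = j then (j.factorial : ℝ) else 0 := by
  rw [iterate_derivative_X_sub_pow]
  split_ifs with h
  · subst h
    simp [Nat.descFactorial_self]
  · rcases Nat.lt_or_gt_of_ne h with h1 | h1
    · simp [zero_pow (show j - k ≠ 0 by omega)]
    · simp [Nat.descFactorial_of_lt h1]

lemma one_sub_X_pow_dvd_iff (M : ℕ) (p : ℝ[X]) :
    (1 - X) ^ M ∣ p ↔ ∀ k < M, (derivative^[k] p).eval 1 = 0 := by
  have hu : IsUnit (C ((-1 : ℝ) ^ M)) := by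
    rw [isUnit_C]
    exact (isUnit_one.neg).pow M
  rw [one_sub_X_pow, hu.mul_left_dvd]
  by_cases hp : p = 0
  · simp [hp]
  rw [← le_rootMultiplicity_iff hp]
  cases M with
  | zero => simp
  | succ M =>
    rw [Nat.succ_le_iff, lt_rootMultiplicity_iff_isRoot_iterate_derivative hp]
    simp only [IsRoot.def, Nat.lt_succ_iff]

lemma one_sub_X_pow_mul_mem_degreeLT_iff (M K : ℕ) (r : ℝ[X]) :
    (1 - X) ^ M * r ∈ degreeLT ℝ (M + K) ↔ r ∈ degreeLT ℝ K := by
  have h : ((1 - X : ℝ[X]) ^ M).degree = M := by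
    rw [one_sub_X_pow, degree_C_mul (by simp), degree_pow, degree_X_sub_C]
    simp
  rw [mem_degreeLT, mem_degreeLT, degree_mul, h]
  by_cases hr : r = 0
  · simp [hr]
  · rw [degree_eq_natDegree hr]
    norm_cast
    omega

/-- The one-variable Sobolev form to which the form on the cone reduces on each solid harmonic. -/
def sobolevForm (α : ℝ) (s : ℕ) (lam : ℕ → ℝ) (p q : ℝ[X]) : ℝ :=
  moment (α + s) (derivative^[s] p * derivative^[s] q) +
    ∑ k ∈ Finset.range s, lam k * ((derivative^[k] p).eval 1 * (derivative^[k] q).eval 1)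

variable {α : ℝ} {s N : ℕ} {lam : ℕ → ℝ} {p : ℝ[X]}

/-- Vanishing of `p` to order `s` at `1` kills both the boundary sum and the boundary terms of the
`s` integrations by parts; nothing is asked of `q`. -/
lemma sobolevForm_of_dvd (hα : -1 < α) (hp : (1 - X) ^ s ∣ p) (q : ℝ[X]) :
    sobolevForm α s lam p q = (-1) ^ s *
      moment α (p * diagonal (fun i => poch (α + 1 + i) s) (derivative^[s] q)) := by
  rw [one_sub_X_pow_dvd_iff] at hp
  rw [sobolevForm, moment_iterate_derivative_mul hα p s hp, Finset.sum_eq_zero, add_zero]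
  intro k hk
  rw [hp k (Finset.mem_range.mp hk), zero_mul, mul_zero]

/-- The test polynomial `(t-1)^k` has zero `s`-th derivative and only its `k`-th derivative at `1`
is nonzero, so the form reduces to `λ_k k! p^(k)(1)`. -/
lemma iterate_derivative_eval_one_of_sobolevForm (hlam : ∀ k < s, 0 < lam k)
    (h : ∀ q ∈ degreeLT ℝ N, sobolevForm α s lam p q = 0) {k : ℕ} (hks : k < s) (hkN : k < N) :
    (derivative^[k] p).eval 1 = 0 := by
  have hdeg : ((X - C 1 : ℝ[X]) ^ k).degree = k := by
    rw [degree_pow, degree_X_sub_C]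
    simp
  have h1 := h ((X - C 1) ^ k) (by
    rw [mem_degreeLT, hdeg]
    exact_mod_cast hkN)
  have h2 : derivative^[s] ((X - C 1 : ℝ[X]) ^ k) = 0 :=
    iterate_derivative_eq_zero_of_mem_degreeLT (n := k + 1) (by
      rw [mem_degreeLT, hdeg]
      exact_mod_cast k.lt_succ_self) hks
  rw [sobolevForm, h2, mul_zero, map_zero, zero_add,
    Finset.sum_eq_single_of_mem k (Finset.mem_range.mpr hks) fun b _ hb => by
      rw [iterate_derivative_X_sub_one_pow_eval, if_neg hb, mul_zero, mul_zero],
    iterate_derivative_X_sub_one_pow_eval, if_pos rfl] at h1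
  have h3 : (k.factorial : ℝ) ≠ 0 := by positivity
  simpa [(hlam k hks).ne', h3] using h1

/-- Low degree: the Sobolev orthogonal polynomials of degree `N < s` are multiples of
`(1 - X)^N`. -/
lemma sobolevForm_orthogonal_iff_of_lt (hlam : ∀ k < s, 0 < lam k) (hN : N < s)
    (hp : p ∈ degreeLT ℝ (N + 1)) :
    (∀ q ∈ degreeLT ℝ N, sobolevForm α s lam p q = 0) ↔ ∃ c : ℝ, p = (1 - X) ^ N * C c := by
  constructor
  · intro h
    obtain ⟨r, rfl⟩ := (one_sub_X_pow_dvd_iff N p).mpr fun k hk =>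
      iterate_derivative_eval_one_of_sobolevForm hlam h (hk.trans hN) hk
    rw [one_sub_X_pow_mul_mem_degreeLT_iff, mem_degreeLT_iff_coeff] at hp
    refine ⟨r.coeff 0, ?_⟩
    congr 1
    ext m
    cases m with
    | zero => simp
    | succ m => rw [hp (m + 1) (by omega), coeff_C_succ]
  · rintro ⟨c, rfl⟩ q hq
    have h1 := (one_sub_X_pow_dvd_iff N ((1 - X) ^ N * C c)).mp (dvd_mul_right _ _)
    -- The integral drops out because `p` has degree at most `N < s`. In the boundary sum `p`
    -- vanishes for `k < N`, and for `k ≥ N` the derivative of `q` does.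
    rw [sobolevForm, iterate_derivative_eq_zero_of_mem_degreeLT hp hN, zero_mul, map_zero, zero_add]
    refine Finset.sum_eq_zero fun k _ => ?_
    rcases lt_or_ge k N with hk | hk
    · rw [h1 k hk, zero_mul, mul_zero]
    · rw [iterate_derivative_eq_zero_of_mem_degreeLT hq hk, eval_zero, mul_zero, mul_zero]

/-- High degree: the Sobolev orthogonal polynomials of degree `N ≥ s` are `(1 - X)^s` times the
orthogonal polynomials of degree `N - s` for the weight `t^α (1 - t)^s`. -/
lemma sobolevForm_orthogonal_iff_of_le (hα : -1 < α) (hlam : ∀ k < s, 0 < lam k) (hN : s ≤ N)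
    (hp : p ∈ degreeLT ℝ (N + 1)) :
    (∀ q ∈ degreeLT ℝ N, sobolevForm α s lam p q = 0) ↔
      ∃ r ∈ degreeLT ℝ (N - s + 1), p = (1 - X) ^ s * r ∧
        ∀ q ∈ degreeLT ℝ (N - s), moment α ((1 - X) ^ s * (r * q)) = 0 := by
  constructor
  · intro h
    obtain ⟨r, rfl⟩ := (one_sub_X_pow_dvd_iff s p).mpr fun k hk =>
      iterate_derivative_eval_one_of_sobolevForm hlam h hk (hk.trans_le hN)
    rw [show N + 1 = s + (N - s + 1) by omega, one_sub_X_pow_mul_mem_degreeLT_iff] at hp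
    refine ⟨r, hp, rfl, fun q hq => ?_⟩
    have hc : ∀ i : ℕ, poch (α + 1 + i) s ≠ 0 := fun i => by
      have : (0 : ℝ) ≤ i := Nat.cast_nonneg i
      exact (ascPochhammer_pos s _ (by linarith)).ne'
    -- `Q` is an `s`-fold antiderivative of `D⁻¹ q`, so `D(Q^(s)) = q`, and its degree is below `(N
    -- - s) + s = N`.
    obtain ⟨Q, hQ, hQs⟩ := exists_iterate_derivative_eq
      (diagonal_mem_degreeLT (fun i => (poch (α + 1 + i) s)⁻¹) hq) s
    have h1 := h Q (by rwa [Nat.sub_add_cancel hN] at hQ)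
    have h2 : diagonal (fun i => poch (α + 1 + i) s)
        (diagonal (fun i => (poch (α + 1 + i) s)⁻¹) q) = q := by
      ext n
      rw [coeff_diagonal, coeff_diagonal, mul_inv_cancel_left₀ (hc n)]
    rw [sobolevForm_of_dvd hα (dvd_mul_right _ _), hQs, h2, mul_assoc] at h1
    exact (mul_eq_zero.mp h1).resolve_left (by simp)
  · rintro ⟨r, _, rfl, h⟩ q hq
    rw [sobolevForm_of_dvd hα (dvd_mul_right _ _), mul_assoc,
      h _ (diagonal_mem_degreeLT _ (iterate_derivative_mem_degreeLT hq s)), mul_zero]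

end OneVariable

/-! ### Expansion of polynomials on the cone in solid harmonics -/

/-- A basis of the space of all solid harmonics, consisting of homogeneous polynomials `Y i` of
degree `deg i` that are orthonormal on the unit sphere. -/
structure IsHarmonicBasis {d : ℕ} {ι : Type*} [DecidableEq ι] (deg : ι → ℕ)
    (Y : ι → MvPolynomial (Fin d) ℝ) : Prop where
  mem : ∀ i, Y i ∈ solidHarmonics d (deg i)
  orthonormal : ∀ i j, 1 / omega d * sphereIntegral d (fun ξ => evalX (Y i) ξ * evalX (Y j) ξ) =
    if i = j then 1 else 0
  le_span : ∀ m, solidHarmonics d m ≤ Submodule.span ℝ {p | ∃ i, deg i = m ∧ Y i = p}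

section Expansion

open MvPolynomial

variable {d : ℕ}

/-- The polynomial `p(t) y(x)`. -/
def tMul (p : Polynomial ℝ) (y : MvPolynomial (Fin d) ℝ) : Poly d :=
  Polynomial.aeval (X none) p * rename some y

lemma evalXT_tMul (p : Polynomial ℝ) (y : MvPolynomial (Fin d) ℝ)
    (x : EuclideanSpace ℝ (Fin d)) (t : ℝ) : evalXT (tMul p y) x t = p.eval t * evalX y x := by
  have h1 : eval (fun o : Option (Fin d) => o.elim t (fun i => x i)) (Polynomial.aeval (X none) p) =
      p.eval t := by
    induction p using Polynomial.induction_on' with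
    | add p q hp hq => simp [hp, hq]
    | monomial n a => simp [Polynomial.aeval_monomial, algebraMap_eq]
  have h2 : eval (fun o : Option (Fin d) => o.elim t (fun i => x i)) (rename some y) =
      evalX y x := by
    rw [eval_rename]
    rfl
  rw [evalXT, tMul, map_mul, h1, h2]

lemma pderiv_none_rename (y : MvPolynomial (Fin d) ℝ) :
    pderiv none (rename some y : Poly d) = 0 := by
  classical
  refine pderiv_eq_zero_of_notMem_vars fun h => ?_
  simpa using vars_rename some y h

lemma dt_tMul (p : Polynomial ℝ) (y : MvPolynomial (Fin d) ℝ) :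
    dt d (tMul p y) = tMul (Polynomial.derivative p) y := by
  simp [dt, tMul, pderiv_none_rename, Derivation.map_aeval, mul_comm]

lemma laplacianX_apply (P : Poly d) :
    laplacianX d P = ∑ i, pderiv (some i) (pderiv (some i) P) := by
  simp [laplacianX]

lemma laplacianX_tMul (p : Polynomial ℝ) (y : MvPolynomial (Fin d) ℝ) :
    laplacianX d (tMul p y) = tMul p (laplacian d y) := by
  have h : ∀ (i : Fin d) (y : MvPolynomial (Fin d) ℝ),
      pderiv (some i) (tMul p y) = tMul p (pderiv i y) := fun i y => by
    simp [tMul, Derivation.map_aeval, pderiv_rename (Option.some_injective (Fin d))]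
  simp only [laplacianX_apply, h, laplacian_apply]
  simp [tMul, Finset.mul_sum]

lemma totalDegree_tMul_le (p : Polynomial ℝ) (y : MvPolynomial (Fin d) ℝ) :
    (tMul p y).totalDegree ≤ p.natDegree + y.totalDegree := by
  refine (totalDegree_mul _ _).trans (add_le_add ?_ (totalDegree_rename_le _ _))
  rw [Polynomial.aeval_eq_sum_range]
  refine totalDegree_finsetSum_le fun i hi => (totalDegree_smul_le _ _).trans ?_
  rw [totalDegree_X_pow]
  exact Nat.lt_succ_iff.mp (Finset.mem_range.mp hi)

lemma coeff_laplacian (p : MvPolynomial (Fin d) ℝ) (e : Fin d →₀ ℕ) :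
    coeff e (laplacian d p) = ∑ i, coeff (e + Finsupp.single i 1 + Finsupp.single i 1) p *
      (((e + Finsupp.single i 1 : Fin d →₀ ℕ) i : ℝ) + 1) * (e i + 1) := by
  rw [laplacian_apply, coeff_sum]
  exact Finset.sum_congr rfl fun i _ => by rw [coeff_pderiv, coeff_pderiv]

/-- A coefficient of `Δp` at an exponent of degree `r` involves only coefficients of `p` of degree
`r + 2`, so homogeneous components do not mix. -/
lemma laplacian_homogeneousComponent {p : MvPolynomial (Fin d) ℝ} (hp : laplacian d p = 0)
    (m : ℕ) : laplacian d (homogeneousComponent m p) = 0 := by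
  ext e
  have h1 := congrArg (coeff e) hp
  rw [coeff_laplacian, coeff_zero] at h1
  rw [coeff_laplacian, coeff_zero]
  simp only [coeff_homogeneousComponent, map_add, Finsupp.degree_single]
  split_ifs
  · exact h1
  · simp

lemma laplacian_eq_zero_of_isHomogeneous_of_lt {p : MvPolynomial (Fin d) ℝ} {m : ℕ}
    (hp : p.IsHomogeneous m) (hm : m < 2) : laplacian d p = 0 := by
  ext e
  rw [coeff_laplacian, coeff_zero]
  refine Finset.sum_eq_zero fun i _ => ?_
  rw [hp.coeff_eq_zero (by simp only [map_add, Finsupp.degree_single]; omega), zero_mul, zero_mul]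

lemma coeff_optionEquivLeft_pderiv (i : Fin d) (P : Poly d) (k : ℕ) :
    (optionEquivLeft ℝ (Fin d) (pderiv (some i) P)).coeff k =
      pderiv i ((optionEquivLeft ℝ (Fin d) P).coeff k) := by
  ext e
  have he : e.optionElim k + Finsupp.single (some i) 1 =
      (e + Finsupp.single i 1).optionElim k := by
    classical
    ext o
    cases o with
    | none => simp
    | some j => simp [Finsupp.single_apply]
  rw [optionEquivLeft_coeff_coeff, coeff_pderiv, coeff_pderiv, optionEquivLeft_coeff_coeff, he]
  simp

/-- With `P` viewed as a polynomial in `t` over `ℝ[x]`, harmonicity in `x` becomes harmonicity of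
each coefficient. -/
lemma coeff_optionEquivLeft_laplacianX (P : Poly d) (k : ℕ) :
    (optionEquivLeft ℝ (Fin d) (laplacianX d P)).coeff k =
      laplacian d ((optionEquivLeft ℝ (Fin d) P).coeff k) := by
  simp only [laplacianX_apply, map_sum, Polynomial.finsetSum_coeff, coeff_optionEquivLeft_pderiv,
    laplacian_apply]

lemma eq_sum_tMul (P : Poly d) :
    P = ∑ k ∈ (optionEquivLeft ℝ (Fin d) P).support,
      tMul (Polynomial.X ^ k) ((optionEquivLeft ℝ (Fin d) P).coeff k) := by
  apply (optionEquivLeft ℝ (Fin d)).injective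
  have h : ∀ y : MvPolynomial (Fin d) ℝ,
      optionEquivLeft ℝ (Fin d) (rename some y) = Polynomial.C y := fun y => by
    induction y using MvPolynomial.induction_on with
    | C a => simp [optionEquivLeft_C]
    | add p q hp hq => simp [hp, hq]
    | mul_X p i hp => simp [hp, optionEquivLeft_X_some]
  conv_lhs => rw [Polynomial.as_sum_support (optionEquivLeft ℝ (Fin d) P)]
  rw [map_sum]
  refine Finset.sum_congr rfl fun k _ => ?_
  simp only [tMul, map_mul, map_pow, Polynomial.aeval_X, optionEquivLeft_X_none, h]
  rw [mul_comm, Polynomial.C_mul_X_pow_eq_monomial]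

lemma tMul_add_right (p : Polynomial ℝ) (y z : MvPolynomial (Fin d) ℝ) :
    tMul p (y + z) = tMul p y + tMul p z := by simp [tMul, mul_add]

lemma tMul_add_left (p q : Polynomial ℝ) (y : MvPolynomial (Fin d) ℝ) :
    tMul (p + q) y = tMul p y + tMul q y := by simp [tMul, add_mul]

lemma tMul_smul_right (c : ℝ) (p : Polynomial ℝ) (y : MvPolynomial (Fin d) ℝ) :
    tMul p (c • y) = c • tMul p y := by simp [tMul]

lemma tMul_smul_left (c : ℝ) (p : Polynomial ℝ) (y : MvPolynomial (Fin d) ℝ) :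
    tMul (c • p) y = c • tMul p y := by simp [tMul]

/-- A polynomial in `(x,t)` is a sum of terms `t^k y(x)` with `y` homogeneous. -/
lemma eq_sum_sum_tMul (P : Poly d) :
    P = ∑ k ∈ (optionEquivLeft ℝ (Fin d) P).support,
      ∑ m ∈ Finset.range (((optionEquivLeft ℝ (Fin d) P).coeff k).totalDegree + 1),
        tMul (Polynomial.X ^ k)
          (homogeneousComponent m ((optionEquivLeft ℝ (Fin d) P).coeff k)) := by
  conv_lhs => rw [eq_sum_tMul P]
  refine Finset.sum_congr rfl fun k _ => ?_
  conv_lhs => rw [← sum_homogeneousComponent ((optionEquivLeft ℝ (Fin d) P).coeff k)]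
  simp only [tMul, map_sum, Finset.mul_sum]

lemma add_le_totalDegree_of_mem_support {P : Poly d} {k m : ℕ}
    (hk : k ∈ (optionEquivLeft ℝ (Fin d) P).support)
    (hm : m ∈ Finset.range (((optionEquivLeft ℝ (Fin d) P).coeff k).totalDegree + 1)) :
    k + m ≤ P.totalDegree := by
  have h1 : k ≤ P.totalDegree := (Polynomial.le_natDegree_of_mem_supp k hk).trans
    (by rw [natDegree_optionEquivLeft]; exact degreeOf_le_totalDegree P none)
  have h2 := totalDegree_coeff_optionEquivLeft_add_le ℝ (Fin d) P k h1
  rw [Finset.mem_range] at hm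
  omega

/-! ### Coefficient families over a harmonic basis. -/

variable {ι : Type*} (Y : ι → MvPolynomial (Fin d) ℝ)

/-- The polynomial `∑ c_i(t) Y_i(x)`. -/
def synth : (ι →₀ Polynomial ℝ) →ₗ[ℝ] Poly d :=
  Finsupp.lsum ℝ fun i =>
    { toFun := fun p => tMul p (Y i)
      map_add' := fun p q => tMul_add_left p q (Y i)
      map_smul' := fun c p => tMul_smul_left c p (Y i) }

/-- The restriction of `∑ c_i(t) Y_i(x)` to the cone. -/
def coneSynth : (ι →₀ Polynomial ℝ) →ₗ[ℝ] (cone d → ℝ) := restrict d ∘ₗ synth Y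

@[simp] lemma synth_single (i : ι) (p : Polynomial ℝ) :
    synth Y (Finsupp.single i p) = tMul p (Y i) := by
  rw [synth, Finsupp.lsum_single]
  rfl

/-- The coefficient families of the polynomials of degree less than `n`. -/
def boundedCoeffs (deg : ι → ℕ) (n : ℕ) : Submodule ℝ (ι →₀ Polynomial ℝ) where
  carrier := {c | ∀ i, c i ∈ Polynomial.degreeLT ℝ (n - deg i)}
  zero_mem' := fun _ => zero_mem _
  add_mem' := fun hc hc' i => add_mem (hc i) (hc' i)
  smul_mem' := fun a _ hc i => Submodule.smul_mem _ a (hc i)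

variable {Y} {deg : ι → ℕ} [DecidableEq ι]

lemma single_mem_boundedCoeffs {i : ι} {p : Polynomial ℝ} {n : ℕ}
    (hp : p ∈ Polynomial.degreeLT ℝ (n - deg i)) :
    Finsupp.single i p ∈ boundedCoeffs deg n := by
  intro j
  by_cases h : i = j
  · subst h; simpa using hp
  · rw [Finsupp.single_eq_of_ne' h]
    exact zero_mem _

lemma laplacianX_synth (hY : IsHarmonicBasis deg Y) (c : ι →₀ Polynomial ℝ) :
    laplacianX d (synth Y c) = 0 := by
  induction c using Finsupp.induction_linear with
  | zero => simp
  | add f g hf hg => rw [map_add, map_add, hf, hg, add_zero]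
  | single i p =>
    have : laplacian d (Y i) = 0 := (hY.mem i).2
    rw [synth_single, laplacianX_tMul, this, tMul, map_zero, mul_zero]

/-- A nonzero `p` in `degreeLT (n - deg i)` forces `deg i < n` despite the truncated subtraction.
The zero polynomial is excluded because its total degree `0` is not below `n = 0`. -/
lemma totalDegree_tMul_lt (hY : IsHarmonicBasis deg Y) {i : ι} {p : Polynomial ℝ} {n : ℕ}
    (hp : p ∈ Polynomial.degreeLT ℝ (n - deg i)) (h0 : p ≠ 0) :
    (tMul p (Y i)).totalDegree < n := by
  have h1 : (Y i).totalDegree ≤ deg i := IsHomogeneous.totalDegree_le (hY.mem i).1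
  have h2 := totalDegree_tMul_le p (Y i)
  rw [Polynomial.mem_degreeLT, Polynomial.degree_eq_natDegree h0, Nat.cast_lt] at hp
  omega

lemma totalDegree_synth_le (hY : IsHarmonicBasis deg Y) {c : ι →₀ Polynomial ℝ} {n : ℕ}
    (hc : c ∈ boundedCoeffs deg (n + 1)) : (synth Y c).totalDegree ≤ n := by
  rw [← c.sum_single, Finsupp.sum, map_sum]
  refine totalDegree_finsetSum_le fun i hi => ?_
  rw [synth_single]
  exact Nat.lt_succ_iff.mp (totalDegree_tMul_lt hY (hc i) (Finsupp.mem_support_iff.mp hi))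

lemma tMul_mem_map_synth (hY : IsHarmonicBasis deg Y) {k m n : ℕ} (hkm : k + m < n)
    {y : MvPolynomial (Fin d) ℝ} (hy : y ∈ solidHarmonics d m) :
    tMul (Polynomial.X ^ k) y ∈ (boundedCoeffs deg n).map (synth Y) := by
  replace hy := hY.le_span m hy
  induction hy using Submodule.span_induction with
  | mem z hz =>
    obtain ⟨i, rfl, rfl⟩ := hz
    refine ⟨Finsupp.single i (Polynomial.X ^ k), single_mem_boundedCoeffs ?_, synth_single Y i _⟩
    rw [Polynomial.mem_degreeLT, Polynomial.degree_X_pow]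
    exact_mod_cast (by omega : k < n - deg i)
  | zero => simp [tMul]
  | add y z _ _ hy hz =>
    rw [tMul_add_right]
    exact add_mem hy hz
  | smul a y _ hy =>
    rw [tMul_smul_right]
    exact Submodule.smul_mem _ a hy

lemma mem_map_synth_of_laplacianX_eq_zero (hY : IsHarmonicBasis deg Y) {P : Poly d} {n : ℕ}
    (hP : laplacianX d P = 0) (hn : P.totalDegree < n) :
    P ∈ (boundedCoeffs deg n).map (synth Y) := by
  rw [eq_sum_sum_tMul P]
  refine sum_mem fun k hk => sum_mem fun m hm => tMul_mem_map_synth hY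
    ((add_le_totalDegree_of_mem_support hk hm).trans_lt hn)
    ⟨homogeneousComponent_isHomogeneous m _, laplacian_homogeneousComponent ?_ m⟩
  rw [← coeff_optionEquivLeft_laplacianX, hP, map_zero, Polynomial.coeff_zero]

lemma restrict_tMul_normSq_mul (p : Polynomial ℝ) (q : MvPolynomial (Fin d) ℝ) :
    restrict d (tMul p (normSq d * q)) = restrict d (tMul (p * Polynomial.X ^ 2) q) := by
  funext z
  have h1 : ‖z.1.1‖ = z.1.2 := z.2.1
  have h2 : evalX (normSq d) z.1.1 = z.1.2 ^ 2 := by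
    rw [← h1, EuclideanSpace.norm_sq_eq]
    simp [evalX, normSq]
  change evalXT _ _ _ = evalXT _ _ _
  rw [evalXT_tMul, evalXT_tMul, evalX_mul, h2, Polynomial.eval_mul, Polynomial.eval_pow,
    Polynomial.eval_X]
  ring

/-- Write `y = h + ‖x‖² q` with `h` harmonic. On the cone `t^k y = t^k h + t^(k+2) q`: the total
degree `k + m` is preserved while the degree in `x` drops, so induction on `m` with `k` free
applies. -/
lemma restrict_tMul_mem_map_coneSynth (hd : 1 ≤ d) (hY : IsHarmonicBasis deg Y) {m n : ℕ} :
    ∀ {k : ℕ}, k + m < n → ∀ {y : MvPolynomial (Fin d) ℝ}, y.IsHomogeneous m →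
      restrict d (tMul (Polynomial.X ^ k) y) ∈ (boundedCoeffs deg n).map (coneSynth Y) := by
  have hharm : ∀ {k m : ℕ}, k + m < n → ∀ {y : MvPolynomial (Fin d) ℝ},
      y ∈ solidHarmonics d m →
        restrict d (tMul (Polynomial.X ^ k) y) ∈ (boundedCoeffs deg n).map (coneSynth Y) := by
    intro k m hkm y hy
    rw [coneSynth, Submodule.map_comp]
    exact Submodule.mem_map_of_mem (tMul_mem_map_synth hY hkm hy)
  induction m using Nat.strong_induction_on with
  | _ m ih =>
    intro k hkm y hy
    rcases lt_or_ge m 2 with hm | hm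
    · exact hharm hkm ⟨hy, laplacian_eq_zero_of_isHomogeneous_of_lt hy hm⟩
    · obtain ⟨j, rfl⟩ : ∃ j, m = j + 2 := ⟨m - 2, by omega⟩
      obtain ⟨h, hh, q, hq, rfl⟩ := exists_eq_add_normSq_mul hd hy
      rw [tMul_add_right, map_add, restrict_tMul_normSq_mul, ← pow_add]
      exact add_mem (hharm hkm hh) (ih j (by omega) (by omega) hq)

/-- On the cone every polynomial is harmonic in `x`, without an increase of the degree. -/
lemma restrict_mem_map_coneSynth (hd : 1 ≤ d) (hY : IsHarmonicBasis deg Y) {P : Poly d} {n : ℕ}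
    (hn : P.totalDegree < n) : restrict d P ∈ (boundedCoeffs deg n).map (coneSynth Y) := by
  rw [eq_sum_sum_tMul P]
  simp only [map_sum]
  exact sum_mem fun k hk => sum_mem fun m hm => restrict_tMul_mem_map_coneSynth hd hY
    ((add_le_totalDegree_of_mem_support hk hm).trans_lt hn)
    (homogeneousComponent_isHomogeneous m _)

end Expansion

/-! ### Inner products on the cone in terms of the coefficients -/

section InnerProducts

open MvPolynomial

variable {d : ℕ} {ι : Type*} {deg : ι → ℕ} {Y : ι → MvPolynomial (Fin d) ℝ}

/-- Differentiation of the coefficients. -/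
def derivCoeffs : (ι →₀ Polynomial ℝ) →ₗ[ℝ] (ι →₀ Polynomial ℝ) :=
  Finsupp.mapRange.linearMap Polynomial.derivative

lemma dt_iterate_synth (c : ι →₀ Polynomial ℝ) (k : ℕ) :
    (dt d)^[k] (synth Y c) = synth Y (derivCoeffs^[k] c) := by
  have h : Function.Semiconj (synth Y) derivCoeffs (dt d) := by
    intro c
    induction c using Finsupp.induction_linear with
    | zero => simp
    | add f g hf hg => simp only [map_add, hf, hg]
    | single i p => simp [derivCoeffs, dt_tMul]
  exact (h.iterate_right k c).symm

lemma derivCoeffs_iterate_apply (c : ι →₀ Polynomial ℝ) (k : ℕ) (i : ι) :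
    (derivCoeffs^[k] c) i = Polynomial.derivative^[k] (c i) := by
  induction k generalizing c with
  | zero => rfl
  | succ k ih => rw [Function.iterate_succ_apply, ih]; rfl

lemma derivCoeffs_iterate_single (i : ι) (q : Polynomial ℝ) (k : ℕ) :
    derivCoeffs^[k] (Finsupp.single i q) = Finsupp.single i (Polynomial.derivative^[k] q) := by
  induction k generalizing q with
  | zero => rfl
  | succ k ih =>
    rw [Function.iterate_succ_apply, Function.iterate_succ_apply, ← ih]
    simp [derivCoeffs]

variable [DecidableEq ι]

lemma omega_pos (hd : 1 ≤ d) : 0 < omega d := by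
  have hd' : (0 : ℝ) < d := by exact_mod_cast hd
  have : 0 < Real.Gamma ((d : ℝ) / 2) := Real.Gamma_pos_of_pos (by positivity)
  have := Real.pi_pos
  unfold omega
  positivity

/-- The coefficient `c_i` is recovered by integration against `Y_i` over a sphere. -/
lemma sphereIntegral_synth_mul (hd : 1 ≤ d) (hY : IsHarmonicBasis deg Y) (c : ι →₀ Polynomial ℝ)
    (i : ι) (r t : ℝ) :
    sphereIntegral d (fun ξ => evalXT (synth Y c) (r • ξ) t * evalX (Y i) ξ) =
      omega d * (r ^ deg i * (c i).eval t) := by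
  induction c using Finsupp.induction_linear with
  | zero => simp [evalXT, sphereIntegral]
  | add f g hf hg =>
    have hc : ∀ h : ι →₀ Polynomial ℝ, Continuous fun ξ : EuclideanSpace ℝ (Fin d) =>
        evalXT (synth Y h) (r • ξ) t * evalX (Y i) ξ := fun h =>
      ((continuous_evalXT (synth Y h)).comp
        (f := fun ξ : EuclideanSpace ℝ (Fin d) => (r • ξ, t)) (by fun_prop)).mul
        (continuous_evalX (Y i))
    simp only [map_add, evalXT_add, add_mul]
    rw [sphereIntegral_add (hc f) (hc g), hf, hg, Finsupp.add_apply, Polynomial.eval_add]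
    ring
  | single j p =>
    have ho : sphereIntegral d (fun ξ => evalX (Y j) ξ * evalX (Y i) ξ) =
        omega d * (if j = i then 1 else 0) := by
      rw [← hY.orthonormal j i, ← mul_assoc, mul_one_div_cancel (omega_pos hd).ne', one_mul]
    have hj : (Y j).IsHomogeneous (deg j) := (hY.mem j).1
    simp only [synth_single, evalXT_tMul, evalX_smul_of_isHomogeneous hj]
    have : ∀ ξ : EuclideanSpace ℝ (Fin d), p.eval t * (r ^ deg j * evalX (Y j) ξ) * evalX (Y i) ξ =
        p.eval t * r ^ deg j * (evalX (Y j) ξ * evalX (Y i) ξ) := fun ξ => by ring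
    simp only [this, sphereIntegral_const_mul, ho]
    by_cases h : j = i
    · subst h
      simp
      ring
    · simp [h, Finsupp.single_eq_of_ne']

lemma coneIntegral_congr {f g : EuclideanSpace ℝ (Fin d) → ℝ → ℝ}
    (h : ∀ t ∈ Set.Ioc (0 : ℝ) 1, ∀ ξ : EuclideanSpace ℝ (Fin d), ‖ξ‖ = 1 →
      f (t • ξ) t = g (t • ξ) t) : coneIntegral d f = coneIntegral d g := by
  refine intervalIntegral.integral_congr_ae (Filter.Eventually.of_forall fun t ht => ?_)
  rw [Set.uIoc_of_le zero_le_one] at ht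
  simp only [sphereIntegral]
  congr 2
  ext ξ
  exact h t ht ξ (by simp)

/-- The sphere integral is evaluated separately for each `t`, so `w` may be any function. The factor
`t^(2 deg i)` comes from the homogeneity of the two harmonics at `tξ`. -/
lemma coneIntegral_synth_mul (hd : 1 ≤ d) (hY : IsHarmonicBasis deg Y) (c : ι →₀ Polynomial ℝ)
    (i : ι) (q : Polynomial ℝ) (w : ℝ → ℝ) :
    coneIntegral d (fun x t => evalXT (synth Y c) x t *
        evalXT (synth Y (Finsupp.single i q)) x t * w t) =
      omega d * ∫ t in (0 : ℝ)..1, t ^ (d - 1) * (t ^ (2 * deg i) * ((c i) * q).eval t * w t) := by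
  have hi : (Y i).IsHomogeneous (deg i) := (hY.mem i).1
  rw [← intervalIntegral.integral_const_mul, coneIntegral]
  refine intervalIntegral.integral_congr fun t _ => ?_
  have h : ∀ ξ : EuclideanSpace ℝ (Fin d), evalXT (synth Y c) (t • ξ) t *
      evalXT (synth Y (Finsupp.single i q)) (t • ξ) t * w t =
      (q.eval t * t ^ deg i * w t) * (evalXT (synth Y c) (t • ξ) t * evalX (Y i) ξ) := fun ξ => by
    rw [synth_single, evalXT_tMul, evalX_smul_of_isHomogeneous hi]
    ring
  simp only [h, sphereIntegral_const_mul, sphereIntegral_synth_mul hd hY, Polynomial.eval_mul]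
  ring

lemma integral_cone_rpow (hd : 1 ≤ d) {γ : ℝ} (hγ : -(d : ℝ) < γ) (m : ℕ) (p : Polynomial ℝ) :
    ∫ t in (0 : ℝ)..1, t ^ (d - 1) * (t ^ (2 * m) * p.eval t * t ^ γ) =
      moment (2 * m + γ + d - 1) p := by
  have hm : (0 : ℝ) ≤ m := Nat.cast_nonneg m
  rw [← (integral_rpow_mul_eval (by linarith) p).2]
  refine intervalIntegral.integral_congr_ae (Filter.Eventually.of_forall fun t ht => ?_)
  rw [Set.uIoc_of_le zero_le_one] at ht
  have h1 : 2 * (m : ℝ) + γ + d - 1 = ((d - 1 : ℕ) : ℝ) + ((2 * m : ℕ) : ℝ) + γ := by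
    rw [Nat.cast_sub hd]
    push_cast
    ring
  rw [h1, Real.rpow_add ht.1, Real.rpow_add ht.1, Real.rpow_natCast, Real.rpow_natCast]
  ring

/-- Since `∂_t` acts on the coefficients alone, orthonormality of the `Y_i` diagonalizes the
product. The harmonic degree survives only in the exponent of `t`. -/
lemma sobolevInner_synth_single (hd : 1 ≤ d) (hY : IsHarmonicBasis deg Y) {β : ℝ} {s : ℕ}
    (hβ : -(d : ℝ) - s < β) (lam : ℕ → ℝ) (c : ι →₀ Polynomial ℝ) (i : ι) (q : Polynomial ℝ) :
    sobolevInner d β s lam (synth Y c) (synth Y (Finsupp.single i q)) =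
      sobolevForm (2 * deg i + β + d - 1) s lam (c i) q := by
  have hω := (omega_pos hd).ne'
  have h1 : 2 * (deg i : ℝ) + (β + s) + d - 1 = 2 * deg i + β + d - 1 + s := by ring
  have h2 : ∀ k, sphereIntegral d (fun ξ =>
      evalXT ((dt d)^[k] (synth Y c)) ξ 1 *
        evalXT ((dt d)^[k] (synth Y (Finsupp.single i q))) ξ 1) =
      omega d * ((Polynomial.derivative^[k] (c i)).eval 1 *
        (Polynomial.derivative^[k] q).eval 1) := fun k => by
    have h3 : ∀ ξ : EuclideanSpace ℝ (Fin d), evalXT ((dt d)^[k] (synth Y c)) ξ 1 *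
        evalXT ((dt d)^[k] (synth Y (Finsupp.single i q))) ξ 1 =
        -- The factor `(1 : ℝ) • ξ` puts the integrand in the shape of `sphereIntegral_synth_mul`
        -- with radius `1`.
        (Polynomial.derivative^[k] q).eval 1 *
          (evalXT (synth Y (derivCoeffs^[k] c)) ((1 : ℝ) • ξ) 1 * evalX (Y i) ξ) := fun ξ => by
      rw [dt_iterate_synth, dt_iterate_synth, derivCoeffs_iterate_single, synth_single,
        evalXT_tMul, one_smul]
      ring
    simp only [h3, sphereIntegral_const_mul, sphereIntegral_synth_mul hd hY,
      derivCoeffs_iterate_apply, one_pow]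
    ring
  rw [sobolevInner, dt_iterate_synth, dt_iterate_synth, derivCoeffs_iterate_single,
    coneIntegral_synth_mul hd hY _ i _ fun t => t ^ (β + s), derivCoeffs_iterate_apply,
    integral_cone_rpow hd (by linarith), h1, sobolevForm]
  simp only [h2]
  congr 1
  · field_simp
  · exact Finset.sum_congr rfl fun k _ => by field_simp

lemma coneInner_synth_single (hd : 1 ≤ d) (hY : IsHarmonicBasis deg Y) {β : ℝ} {s : ℕ}
    (hβ : -(d : ℝ) < β) (c : ι →₀ Polynomial ℝ) (i : ι) (q : Polynomial ℝ) :
    coneInner d β s (synth Y c) (synth Y (Finsupp.single i q)) =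
      normConst d β s * omega d *
        moment (2 * deg i + β + d - 1) ((1 - Polynomial.X) ^ s * (c i * q)) := by
  rw [coneInner, coneIntegral_synth_mul hd hY _ i _ (weight β s), ← integral_cone_rpow hd hβ,
    mul_assoc]
  congr 3
  ext t
  simp only [weight, Real.rpow_natCast, Polynomial.eval_mul, Polynomial.eval_pow,
    Polynomial.eval_sub, Polynomial.eval_one, Polynomial.eval_X]
  ring

lemma normConst_pos (hd : 1 ≤ d) {β γ : ℝ} (hβ : -(d : ℝ) < β) (hγ : -1 < γ) :
    0 < normConst d β γ := by
  have h1 : 0 < Real.Gamma (β + γ + d + 1) := Real.Gamma_pos_of_pos (by linarith)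
  have h2 : 0 < Real.Gamma (β + d) := Real.Gamma_pos_of_pos (by linarith)
  have h3 : 0 < Real.Gamma (γ + 1) := Real.Gamma_pos_of_pos (by linarith)
  have := omega_pos hd
  unfold normConst
  positivity

lemma sobolevInner_comm (β : ℝ) (s : ℕ) (lam : ℕ → ℝ) (P Q : Poly d) :
    sobolevInner d β s lam P Q = sobolevInner d β s lam Q P := by
  simp only [sobolevInner, mul_comm (evalXT ((dt d)^[_] P) _ _)]

lemma coneInner_comm (β γ : ℝ) (P Q : Poly d) : coneInner d β γ P Q = coneInner d β γ Q P := by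
  simp only [coneInner, mul_comm (evalXT P _ _)]

/-- No derivative enters this product, so it sees only values on the cone, and any representative
may be exchanged for the harmonic one. -/
lemma coneInner_congr_left {β γ : ℝ} {P P' : Poly d} (h : restrict d P = restrict d P')
    (Q : Poly d) : coneInner d β γ P Q = coneInner d β γ P' Q := by
  rw [coneInner, coneInner]
  congr 1
  refine coneIntegral_congr fun t ht ξ hξ => ?_
  have h1 : evalXT P (t • ξ) t = evalXT P' (t • ξ) t :=
    congrFun h ⟨(t • ξ, t), by
      simp [cone, norm_smul, hξ, abs_of_pos ht.1, ht.1.le, ht.2]⟩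
  rw [h1]

/-- Orthogonality to all polynomials of degree less than `n` can be tested on the `q(t) Y_i(x)`. -/
lemma forall_sobolevInner_synth_eq_zero_iff (hd : 1 ≤ d) (hY : IsHarmonicBasis deg Y) {β : ℝ}
    {s : ℕ} (hβ : -(d : ℝ) - s < β) (lam : ℕ → ℝ) (c : ι →₀ Polynomial ℝ) (n : ℕ) :
    (∀ Q : Poly d, laplacianX d Q = 0 → Q.totalDegree < n →
        sobolevInner d β s lam (synth Y c) Q = 0) ↔
      ∀ i, ∀ q ∈ Polynomial.degreeLT ℝ (n - deg i),
        sobolevForm (2 * deg i + β + d - 1) s lam (c i) q = 0 := by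
  constructor
  · intro h i q hq
    rw [← sobolevInner_synth_single hd hY hβ]
    by_cases h0 : q = 0
    · rw [h0, Finsupp.single_zero, map_zero, sobolevInner_comm, sobolevInner_zero_left]
    · exact h _ (laplacianX_synth hY _) (by
        rw [synth_single]
        exact totalDegree_tMul_lt hY hq h0)
  · intro h Q hQ hn
    obtain ⟨c', hc', rfl⟩ := mem_map_synth_of_laplacianX_eq_zero hY hQ hn
    let B : Poly d →+ ℝ := AddMonoidHom.mk' (fun Q => sobolevInner d β s lam (synth Y c) Q)
      fun Q Q' => by
        simp only [sobolevInner_comm β s lam (synth Y c), sobolevInner_add_left hβ]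
    change B (synth Y c') = 0
    rw [← c'.sum_single, Finsupp.sum, map_sum, map_sum]
    exact Finset.sum_eq_zero fun i _ =>
      (sobolevInner_synth_single hd hY hβ lam c i (c' i)).trans (h i _ (hc' i))

lemma forall_coneInner_synth_eq_zero_iff (hd : 1 ≤ d) (hY : IsHarmonicBasis deg Y) {β : ℝ}
    {s : ℕ} (hβ : -(d : ℝ) < β) (hs : -1 < (s : ℝ)) (c : ι →₀ Polynomial ℝ) (n : ℕ) :
    (∀ Q : Poly d, Q.totalDegree < n → coneInner d β s (synth Y c) Q = 0) ↔
      ∀ i, ∀ q ∈ Polynomial.degreeLT ℝ (n - deg i),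
        moment (2 * deg i + β + d - 1) ((1 - Polynomial.X) ^ s * (c i * q)) = 0 := by
  have hne : normConst d β s * omega d ≠ 0 :=
    mul_ne_zero (normConst_pos hd hβ hs).ne' (omega_pos hd).ne'
  constructor
  · intro h i q hq
    refine (mul_eq_zero.mp ?_).resolve_left hne
    rw [← coneInner_synth_single hd hY hβ]
    by_cases h0 : q = 0
    · rw [h0, Finsupp.single_zero, map_zero, coneInner_comm, coneInner_zero_left]
    · exact h _ (by
        rw [synth_single]
        exact totalDegree_tMul_lt hY hq h0)
  · intro h Q hn
    -- Here `Q` need not be harmonic in `x`; it is first replaced by its harmonic representative.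
    obtain ⟨c', hc', hQ⟩ := restrict_mem_map_coneSynth hd hY hn
    rw [coneInner_comm, ← coneInner_congr_left hQ, coneInner_comm]
    let B : Poly d →+ ℝ := AddMonoidHom.mk' (fun Q => coneInner d β s (synth Y c) Q)
      fun Q Q' => by
        simp only [coneInner_comm β s (synth Y c), coneInner_add_left hβ hs]
    change B (synth Y c') = 0
    rw [← c'.sum_single, Finsupp.sum, map_sum, map_sum]
    refine Finset.sum_eq_zero fun i _ => (coneInner_synth_single hd hY hβ c i (c' i)).trans ?_
    rw [h i _ (hc' i), mul_zero]

/-- Integration against `Y_i` at height `t` returns `ω_d t^(deg i) c_i(t)`, so a vanishing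
restriction gives `c_i` all of `(0,1]` as roots. -/
lemma coneSynth_injective (hd : 1 ≤ d) (hY : IsHarmonicBasis deg Y) :
    Function.Injective (coneSynth Y) := by
  rw [← LinearMap.ker_eq_bot, LinearMap.ker_eq_bot']
  intro c hc
  ext1 i
  refine Polynomial.eq_zero_of_infinite_isRoot _ ((Set.Ioc_infinite zero_lt_one).mono
    fun t (ht : t ∈ Set.Ioc (0 : ℝ) 1) => ?_)
  have h1 := sphereIntegral_synth_mul hd hY c i t t
  have h2 : sphereIntegral d (fun ξ => evalXT (synth Y c) (t • ξ) t * evalX (Y i) ξ) = 0 := by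
    rw [sphereIntegral]
    refine integral_eq_zero_of_ae (Filter.Eventually.of_forall fun ξ => ?_)
    have h3 : evalXT (synth Y c) (t • (ξ : EuclideanSpace ℝ (Fin d))) t = 0 :=
      congrFun hc ⟨(t • (ξ : EuclideanSpace ℝ (Fin d)), t), by
        simp [cone, norm_smul, abs_of_pos ht.1, ht.1.le, ht.2]⟩
    simp [h3]
  rw [h2, zero_eq_mul, mul_eq_zero] at h1
  exact (h1.resolve_left (omega_pos hd).ne').resolve_left (pow_ne_zero _ ht.1.ne')

/-- Splits the problem into independent one-variable problems, one for each `Y_i`, of degree `n -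
deg i`. -/
lemma mem_sobolevOrthPoly_iff (hd : 1 ≤ d) (hY : IsHarmonicBasis deg Y) {β : ℝ} {s : ℕ}
    (hβ : -(d : ℝ) - s < β) (lam : ℕ → ℝ) (n : ℕ) (f : cone d → ℝ) :
    f ∈ sobolevOrthPoly d β s hβ lam n ↔
      ∃ c ∈ boundedCoeffs deg (n + 1), coneSynth Y c = f ∧
        ∀ i, ∀ q ∈ Polynomial.degreeLT ℝ (n - deg i),
          sobolevForm (2 * deg i + β + d - 1) s lam (c i) q = 0 := by
  constructor
  · rintro ⟨P, hP, hn, rfl, ho⟩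
    obtain ⟨c, hc, rfl⟩ := mem_map_synth_of_laplacianX_eq_zero hY hP (Nat.lt_succ_of_le hn)
    exact ⟨c, hc, rfl, (forall_sobolevInner_synth_eq_zero_iff hd hY hβ lam c n).mp ho⟩
  · rintro ⟨c, hc, rfl, ho⟩
    exact ⟨synth Y c, laplacianX_synth hY c, totalDegree_synth_le hY hc, rfl,
      (forall_sobolevInner_synth_eq_zero_iff hd hY hβ lam c n).mpr ho⟩

lemma mem_orthPoly_iff (hd : 1 ≤ d) (hY : IsHarmonicBasis deg Y) {β : ℝ} {s : ℕ}
    (hβ : -(d : ℝ) < β) (hs : -1 < (s : ℝ)) (n : ℕ) (f : cone d → ℝ) :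
    f ∈ orthPoly d β s hβ hs n ↔
      ∃ c ∈ boundedCoeffs deg (n + 1), coneSynth Y c = f ∧
        ∀ i, ∀ q ∈ Polynomial.degreeLT ℝ (n - deg i),
          moment (2 * deg i + β + d - 1) ((1 - Polynomial.X) ^ s * (c i * q)) = 0 := by
  constructor
  · rintro ⟨P, hn, rfl, ho⟩
    obtain ⟨c, hc, hP⟩ := restrict_mem_map_coneSynth hd hY (Nat.lt_succ_of_le hn)
    refine ⟨c, hc, hP, (forall_coneInner_synth_eq_zero_iff hd hY hβ hs c n).mp fun Q hQ => ?_⟩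
    rw [coneInner_congr_left hP]
    exact ho Q hQ
  · rintro ⟨c, hc, rfl, ho⟩
    exact ⟨synth Y c, totalDegree_synth_le hY hc, rfl,
      (forall_coneInner_synth_eq_zero_iff hd hY hβ hs c n).mpr ho⟩

end InnerProducts

/-! ### The decomposition of the Sobolev orthogonal polynomials -/

section Decomposition

open Polynomial

variable {d : ℕ} {ι : Type*} {deg : ι → ℕ} {Y : ι → MvPolynomial (Fin d) ℝ}

lemma coneSynth_single_apply (i : ι) (q : ℝ[X]) (z : cone d) :
    coneSynth Y (Finsupp.single i q) z = q.eval z.1.2 * evalX (Y i) z.1.1 := by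
  rw [coneSynth, LinearMap.comp_apply, synth_single]
  exact evalXT_tMul _ _ _ _

/-- Multiplication of the coefficients by `(1 - X)^s`. -/
def mulCoeffs (s : ℕ) : (ι →₀ ℝ[X]) →ₗ[ℝ] (ι →₀ ℝ[X]) :=
  Finsupp.mapRange.linearMap (LinearMap.mulLeft ℝ ((1 - X) ^ s))

lemma mulCoeffs_apply (s : ℕ) (c : ι →₀ ℝ[X]) (i : ι) :
    mulCoeffs s c i = (1 - X) ^ s * c i := by
  simp [mulCoeffs]

lemma mulLeft_coneSynth (s : ℕ) (c : ι →₀ ℝ[X]) :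
    LinearMap.mulLeft ℝ (fun p : cone d => (1 - p.1.2) ^ s) (coneSynth Y c) =
      coneSynth Y (mulCoeffs s c) := by
  induction c using Finsupp.induction_linear with
  | zero => simp
  | add f g hf hg => simp only [map_add, hf, hg]
  | single i q =>
    funext z
    have : mulCoeffs s (Finsupp.single i q) = Finsupp.single i ((1 - X) ^ s * q) := by
      simp [mulCoeffs]
    rw [this, coneSynth_single_apply, LinearMap.mulLeft_apply, Pi.mul_apply, coneSynth_single_apply]
    simp [mul_assoc]

variable [DecidableEq ι]

lemma oneSubTPowMul_harmonicsOnCone (hY : IsHarmonicBasis deg Y) (j k : ℕ) :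
    oneSubTPowMul d j (harmonicsOnCone d (k : ℤ)) =
      Submodule.span ℝ {f | ∃ i, deg i = k ∧ coneSynth Y (Finsupp.single i ((1 - X) ^ j)) = f} := by
  have h : solidHarmonics d k = Submodule.span ℝ {p | ∃ i, deg i = k ∧ Y i = p} := by
    refine le_antisymm (hY.le_span k) (Submodule.span_le.mpr ?_)
    rintro _ ⟨i, rfl, rfl⟩
    exact hY.mem i
  rw [oneSubTPowMul, harmonicsOnCone, if_pos (Int.natCast_nonneg k), Int.toNat_natCast, h,
    Submodule.map_span, Submodule.map_span]
  have h1 : ∀ i, LinearMap.mulLeft ℝ (fun p : cone d => (1 - p.1.2) ^ j)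
      ((restrict d ∘ₗ (MvPolynomial.rename (R := ℝ) (some : Fin d → Option (Fin d))).toLinearMap)
        (Y i)) = coneSynth Y (Finsupp.single i ((1 - X) ^ j)) := fun i => by
    have h2 : (restrict d ∘ₗ
        (MvPolynomial.rename (R := ℝ) (some : Fin d → Option (Fin d))).toLinearMap) (Y i) =
        coneSynth Y (Finsupp.single i 1) := by
      rw [coneSynth, LinearMap.comp_apply, LinearMap.comp_apply, synth_single]
      simp [tMul]
    rw [h2, mulLeft_coneSynth]
    simp [mulCoeffs]
  congr 1
  ext f
  constructor
  · rintro ⟨_, ⟨_, ⟨i, hi, rfl⟩, rfl⟩, rfl⟩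
    exact ⟨i, hi, (h1 i).symm⟩
  · rintro ⟨i, hi, rfl⟩
    exact ⟨_, ⟨_, ⟨i, hi, rfl⟩, rfl⟩, h1 i⟩

lemma sobolevForm_zero_left (α : ℝ) (s : ℕ) (lam : ℕ → ℝ) (q : ℝ[X]) :
    sobolevForm α s lam 0 q = 0 := by
  simp [sobolevForm]

lemma eq_zero_of_mem_degreeLT_zero {p : ℝ[X]} (hp : p ∈ degreeLT ℝ 0) : p = 0 := by
  ext m
  simpa using mem_degreeLT_iff_coeff.mp hp m (Nat.zero_le m)

variable {β : ℝ} {s : ℕ} {lam : ℕ → ℝ}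

lemma neg_one_lt_exponent (hβ : -(d : ℝ) < β) (m : ℕ) : -1 < 2 * (m : ℝ) + β + d - 1 := by
  have : (0 : ℝ) ≤ m := Nat.cast_nonneg m
  linarith

lemma oneSubTPowMul_harmonicsOnCone_le (hd : 1 ≤ d) (hY : IsHarmonicBasis deg Y)
    (hβ : -(d : ℝ) - s < β) (hlam : ∀ k < s, 0 < lam k) {j : ℕ} (hj : j < s) (n : ℕ) :
    oneSubTPowMul d j (harmonicsOnCone d ((n : ℤ) - j)) ≤ sobolevOrthPoly d β s hβ lam n := by
  rcases lt_or_ge n j with hn | hn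
  · rw [harmonicsOnCone, if_neg (by omega), oneSubTPowMul, Submodule.map_bot]
    exact bot_le
  rw [← Nat.cast_sub hn, oneSubTPowMul_harmonicsOnCone hY, Submodule.span_le]
  rintro _ ⟨i, hi, rfl⟩
  -- The one-variable degree is `j < s`, so the low-degree criterion applies.
  have hnj : n - deg i = j := by omega
  have hb : (1 - X : ℝ[X]) ^ j ∈ degreeLT ℝ (j + 1) := by
    rw [← mul_one ((1 - X : ℝ[X]) ^ j), one_sub_X_pow_mul_mem_degreeLT_iff, mem_degreeLT]
    simp
  refine (mem_sobolevOrthPoly_iff hd hY hβ lam n _).mpr ⟨_, single_mem_boundedCoeffs ?_, rfl,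
    fun k => ?_⟩
  · rwa [show n + 1 - deg i = j + 1 by omega]
  · by_cases hk : i = k
    · subst hk
      rw [Finsupp.single_eq_same, hnj]
      exact (sobolevForm_orthogonal_iff_of_lt hlam hj hb).mpr ⟨1, by simp⟩
    · intro q _
      rw [Finsupp.single_eq_of_ne' hk, sobolevForm_zero_left]

lemma oneSubTPowMul_orthPolyInt_le (hd : 1 ≤ d) (hY : IsHarmonicBasis deg Y)
    (hβ : -(d : ℝ) - s < β) (hlam : ∀ k < s, 0 < lam k) (hβ' : -(d : ℝ) < β) (hs : -1 < (s : ℝ))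
    (n : ℕ) :
    oneSubTPowMul d s (orthPolyInt d β s hβ' hs ((n : ℤ) - s)) ≤
      sobolevOrthPoly d β s hβ lam n := by
  rcases lt_or_ge n s with hn | hn
  · rw [orthPolyInt, if_neg (by omega), oneSubTPowMul, Submodule.map_bot]
    exact bot_le
  rw [orthPolyInt, if_pos (by omega), ← Nat.cast_sub hn, Int.toNat_natCast]
  rintro _ ⟨f, hf, rfl⟩
  obtain ⟨c, hc, rfl, ho⟩ := (mem_orthPoly_iff hd hY hβ' hs (n - s) f).mp hf
  rw [mulLeft_coneSynth]
  -- These indices are set apart because the high-degree criterion needs `s ≤ n - deg i` and the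
  -- truncated subtractions must not lose information.
  have hzero : ∀ i, n - s < deg i → c i = 0 := fun i hi => by
    have := hc i
    rw [show n - s + 1 - deg i = 0 by omega] at this
    exact eq_zero_of_mem_degreeLT_zero this
  have hb : mulCoeffs s c ∈ boundedCoeffs deg (n + 1) := fun i => by
    rw [mulCoeffs_apply]
    rcases lt_or_ge (n - s) (deg i) with hi | hi
    · rw [hzero i hi, mul_zero]
      exact zero_mem _
    · rw [show n + 1 - deg i = s + (n - s + 1 - deg i) by omega,
        one_sub_X_pow_mul_mem_degreeLT_iff]
      exact hc i
  refine (mem_sobolevOrthPoly_iff hd hY hβ lam n _).mpr ⟨_, hb, rfl, fun i => ?_⟩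
  rcases lt_or_ge (n - s) (deg i) with hi | hi
  · intro q _
    rw [mulCoeffs_apply, hzero i hi, mul_zero, sobolevForm_zero_left]
  · have hbi := hb i
    have hci := hc i
    have hoi := ho i
    rw [show n + 1 - deg i = n - deg i + 1 by omega] at hbi
    rw [show n - s + 1 - deg i = n - deg i - s + 1 by omega] at hci
    rw [show n - s - deg i = n - deg i - s by omega] at hoi
    exact (sobolevForm_orthogonal_iff_of_le (neg_one_lt_exponent hβ' _) hlam (by omega) hbi).mpr
      ⟨c i, hci, mulCoeffs_apply s c i, hoi⟩

/-- Each term `c_i(t) Y_i(x)` can be placed separately: if `n - deg i < s` it lies in the summand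
with `j = n - deg i`, otherwise in the last one. -/
lemma sobolevOrthPoly_le (hd : 1 ≤ d) (hY : IsHarmonicBasis deg Y)
    (hβ : -(d : ℝ) - s < β) (hlam : ∀ k < s, 0 < lam k) (hβ' : -(d : ℝ) < β) (hs : -1 < (s : ℝ))
    (n : ℕ) :
    sobolevOrthPoly d β s hβ lam n ≤
      (⨆ j : Fin s, oneSubTPowMul d j (harmonicsOnCone d ((n : ℤ) - (j : ℕ)))) ⊔
        oneSubTPowMul d s (orthPolyInt d β s hβ' hs ((n : ℤ) - s)) := by
  intro f hf
  obtain ⟨c, hc, rfl, ho⟩ := (mem_sobolevOrthPoly_iff hd hY hβ lam n f).mp hf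
  rw [← c.sum_single, Finsupp.sum, map_sum]
  refine sum_mem fun i hi => ?_
  have hdeg : deg i ≤ n := by
    by_contra h
    have := hc i
    rw [show n + 1 - deg i = 0 by omega] at this
    exact Finsupp.mem_support_iff.mp hi (eq_zero_of_mem_degreeLT_zero this)
  have hci := hc i
  rw [show n + 1 - deg i = n - deg i + 1 by omega] at hci
  rcases lt_or_ge (n - deg i) s with hN | hN
  · obtain ⟨a, ha⟩ := (sobolevForm_orthogonal_iff_of_lt hlam hN hci).mp (ho i)
    refine Submodule.mem_sup_left (Submodule.mem_iSup_of_mem (⟨n - deg i, hN⟩ : Fin s) ?_)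
    have h1 : (n : ℤ) - ((n - deg i : ℕ) : ℤ) = (deg i : ℤ) := by omega
    simp only [h1]
    rw [oneSubTPowMul_harmonicsOnCone hY, ha, mul_comm, ← smul_eq_C_mul, ← Finsupp.smul_single,
      map_smul]
    exact Submodule.smul_mem _ a (Submodule.subset_span ⟨i, rfl, rfl⟩)
  · obtain ⟨r, hr, hcr, hor⟩ := (sobolevForm_orthogonal_iff_of_le (neg_one_lt_exponent hβ' _) hlam
      hN hci).mp (ho i)
    refine Submodule.mem_sup_right ?_
    rw [orthPolyInt, if_pos (by omega), ← Nat.cast_sub (show s ≤ n by omega), Int.toNat_natCast]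
    refine ⟨coneSynth Y (Finsupp.single i r), (mem_orthPoly_iff hd hY hβ' hs (n - s) _).mpr
      ⟨_, single_mem_boundedCoeffs ?_, rfl, fun k q hq => ?_⟩, ?_⟩
    · rwa [show n - s + 1 - deg i = n - deg i - s + 1 by omega]
    · by_cases hk : i = k
      · subst hk
        rw [Finsupp.single_eq_same]
        exact hor q (by rwa [show n - deg i - s = n - s - deg i by omega])
      · rw [Finsupp.single_eq_of_ne' hk, zero_mul, mul_zero, map_zero]
    · rw [mulLeft_coneSynth, hcr]
      simp [mulCoeffs]

/-- The functions on the cone whose expansion involves only the solid harmonics `Y i`, `i ∈ S`. -/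
def coneSupported (Y : ι → MvPolynomial (Fin d) ℝ) (S : Set ι) : Submodule ℝ (cone d → ℝ) :=
  (Finsupp.supported ℝ[X] ℝ S).map (coneSynth Y)

/-- Uniqueness of the expansion turns disjoint index sets into disjoint function spaces; directness
of the sum follows from this alone. -/
lemma disjoint_coneSupported (hd : 1 ≤ d) (hY : IsHarmonicBasis deg Y) {S T : Set ι}
    (h : Disjoint S T) : Disjoint (coneSupported Y S) (coneSupported Y T) :=
  Submodule.disjoint_map (coneSynth_injective hd hY) (Finsupp.disjoint_supported_supported h)

lemma oneSubTPowMul_harmonicsOnCone_le_coneSupported (hY : IsHarmonicBasis deg Y) (j n : ℕ)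
    {S : Set ι} (hS : ∀ i, (deg i : ℤ) = n - j → i ∈ S) :
    oneSubTPowMul d j (harmonicsOnCone d ((n : ℤ) - j)) ≤ coneSupported Y S := by
  rcases lt_or_ge n j with hn | hn
  · rw [harmonicsOnCone, if_neg (by omega), oneSubTPowMul, Submodule.map_bot]
    exact bot_le
  rw [← Nat.cast_sub hn, oneSubTPowMul_harmonicsOnCone hY, Submodule.span_le]
  rintro _ ⟨i, hi, rfl⟩
  exact ⟨_, Finsupp.single_mem_supported ℝ _ (hS i (by omega)), rfl⟩

lemma oneSubTPowMul_orthPolyInt_le_coneSupported (hd : 1 ≤ d) (hY : IsHarmonicBasis deg Y)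
    (hβ' : -(d : ℝ) < β) (hs : -1 < (s : ℝ)) (n : ℕ) :
    oneSubTPowMul d s (orthPolyInt d β s hβ' hs ((n : ℤ) - s)) ≤
      coneSupported Y {i | (deg i : ℤ) ≤ n - s} := by
  rcases lt_or_ge n s with hn | hn
  · rw [orthPolyInt, if_neg (by omega), oneSubTPowMul, Submodule.map_bot]
    exact bot_le
  rw [orthPolyInt, if_pos (by omega), ← Nat.cast_sub hn, Int.toNat_natCast]
  rintro _ ⟨f, hf, rfl⟩
  obtain ⟨c, hc, rfl, -⟩ := (mem_orthPoly_iff hd hY hβ' hs (n - s) f).mp hf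
  rw [mulLeft_coneSynth]
  refine ⟨_, (Finsupp.mem_supported ℝ _).mpr fun i hi => ?_, rfl⟩
  by_contra h
  have h1 := hc i
  simp only [Set.mem_ofPred_eq] at h
  rw [show n - s + 1 - deg i = 0 by omega] at h1
  apply Finsupp.mem_support_iff.mp hi
  rw [mulCoeffs_apply, eq_zero_of_mem_degreeLT_zero h1, mul_zero]

end Decomposition

/-- Orthonormal bases of the spaces of solid harmonics of each degree form an orthonormal basis of
the space of all solid harmonics. -/
lemma isHarmonicBasis_sigma {d : ℕ} (hd : 1 ≤ d)
    (Y : ∀ m : ℕ, Module.Basis (Fin (Module.finrank ℝ (solidHarmonics d m))) ℝ (solidHarmonics d m))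
    (hY : ∀ m ℓ ℓ', 1 / omega d * sphereIntegral d
        (fun ξ => evalX (Y m ℓ : MvPolynomial (Fin d) ℝ) ξ * evalX (Y m ℓ') ξ)
      = if ℓ = ℓ' then 1 else 0) :
    IsHarmonicBasis (ι := Σ m : ℕ, Fin (Module.finrank ℝ (solidHarmonics d m))) Sigma.fst
      fun i => (Y i.1 i.2 : MvPolynomial (Fin d) ℝ) where
  mem i := (Y i.1 i.2).2
  orthonormal := by
    rintro ⟨m, ℓ⟩ ⟨m', ℓ'⟩
    by_cases h : m = m'
    · subst h
      rw [hY]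
      simp
    · rw [sphereIntegral_mul_eq_zero hd h (Y m ℓ).2 (Y m' ℓ').2, mul_zero, if_neg]
      exact fun h' => h (congrArg Sigma.fst h')
  le_span m y hy := by
    have h := congrArg Subtype.val ((Y m).sum_repr ⟨y, hy⟩)
    rw [← show _ = y from h, AddSubmonoidClass.coe_finsetSum]
    exact sum_mem fun ℓ _ => Submodule.smul_mem _ _ (Submodule.subset_span ⟨⟨m, ℓ⟩, rfl, rfl⟩)

end ConeSobolev

end

/-! ### The theorem. -/

theorem mainTheorem10 (d s : ℕ) (hd : 1 ≤ d) (hs : 1 ≤ s) (β : ℝ) (hβ : -(d : ℝ) - s < β)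
    (lam : ℕ → ℝ) (hlam : ∀ k < s, 0 < lam k)
    (Y : ∀ m : ℕ, Module.Basis (Fin (Module.finrank ℝ (solidHarmonics d m))) ℝ (solidHarmonics d m))
    (hY : ∀ m ℓ ℓ', 1 / omega d * sphereIntegral d
        (fun ξ => evalX (Y m ℓ : MvPolynomial (Fin d) ℝ) ξ * evalX (Y m ℓ') ξ)
      = if ℓ = ℓ' then 1 else 0) :
    (∀ (n m : ℕ) (ℓ : Fin (Module.finrank ℝ (solidHarmonics d m))), m ≤ n →
      ∀ (x : EuclideanSpace ℝ (Fin d)) (t : ℝ),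
        (s ≤ n - m → sobolevS d β s n m (Y m ℓ) x t =
          bConst d β s n m * (1 - t) ^ s * coneS d β s (n - s) m (Y m ℓ) x t) ∧
        (n - m < s → sobolevS d β s n m (Y m ℓ) x t =
          2 ^ (n - m) / ((n - m).factorial : ℝ) * (1 - t) ^ (n - m) * evalX (Y m ℓ) x)) ∧
    (∀ (hβ' : -(d : ℝ) < β) (hγ : -1 < (s : ℝ)) (n : ℕ),
      sobolevOrthPoly d β s hβ lam n =
        (⨆ j : Fin s, oneSubTPowMul d j (harmonicsOnCone d ((n : ℤ) - (j : ℕ)))) ⊔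
          oneSubTPowMul d s (orthPolyInt d β s hβ' hγ ((n : ℤ) - s)) ∧
      iSupIndep (fun j : Fin s => oneSubTPowMul d j (harmonicsOnCone d ((n : ℤ) - (j : ℕ)))) ∧
      Disjoint (⨆ j : Fin s, oneSubTPowMul d j (harmonicsOnCone d ((n : ℤ) - (j : ℕ))))
        (oneSubTPowMul d s (orthPolyInt d β s hβ' hγ ((n : ℤ) - s)))) := by
  refine ⟨fun n m ℓ hmn x t => ⟨fun h => sobolevS_eq_coneS d β hs hmn h _ x t,
    fun h => sobolevS_of_lt d β h _ x t⟩, fun hβ' hγ n => ?_⟩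
  have hB := isHarmonicBasis_sigma hd Y hY
  refine ⟨le_antisymm (sobolevOrthPoly_le hd hB hβ hlam hβ' hγ n) (sup_le (iSup_le fun j =>
    oneSubTPowMul_harmonicsOnCone_le hd hB hβ hlam j.2 n)
    (oneSubTPowMul_orthPolyInt_le hd hB hβ hlam hβ' hγ n)), fun j => ?_, ?_⟩
  -- The `j`-th summand uses harmonics of degree exactly `n - j`, and the other summands of the
  -- supremum avoid that degree.
  · refine Disjoint.mono
      (oneSubTPowMul_harmonicsOnCone_le_coneSupported hB j n (S := {i | (i.1 : ℤ) = n - (j : ℕ)})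
        fun i hi => hi)
      (iSup₂_le fun k hk => oneSubTPowMul_harmonicsOnCone_le_coneSupported hB k n
        (S := {i | (i.1 : ℤ) ≠ n - (j : ℕ)}) fun i hi => ?_)
      (disjoint_coneSupported hd hB (Set.disjoint_left.mpr fun i hi hi' => hi' hi))
    have : (k : ℕ) ≠ j := fun h => hk (Fin.ext h)
    simp only [Set.mem_ofPred_eq]
    omega
  -- The degrees `n - j` with `j < s` exceed `n - s`, which bounds the degrees in the last summand.
  · refine Disjoint.mono
      (iSup_le fun k => oneSubTPowMul_harmonicsOnCone_le_coneSupported hB k n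
        (S := {i | (n : ℤ) - s < i.1}) fun i hi => ?_)
      (oneSubTPowMul_orthPolyInt_le_coneSupported hd hB hβ' hγ n)
      (disjoint_coneSupported hd hB (Set.disjoint_left.mpr fun i hi hi' =>
        not_le.mpr (show (n : ℤ) - s < i.1 from hi) hi'))
    have := k.2
    simp only [Set.mem_ofPred_eq]
    omega
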